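/- Let $K$ be an algebraically closed field of characteristic zero, let $(r_1,\dots,r_u)$ be positive integers with sum $n$, and put $R_k=r_1+\dots+r_k$ ($R_0=0$). Call $\{R_{k-1}+1,\dots,R_k\}$ the $k$-th block. Let $B\subset \mathrm{GL}(n,K)$ be the group of invertible upper triangular matrices, let $M$ be the set of pairs $(i,j)$ with $1\le i,j\le n$ such that the block of $i$ precedes the block of $j$, and let $\mathfrak m=\bigoplus_{(i,j)\in M}K E_{i,j}$, the nilradical of the standard parabolic subalgebra with diagonal blocks of sizes $(r_1,\dots,r_u)$. The group $B$ acts on $\mathfrak m$ by $\mathrm{Ad}_g x=gxg^{-1}$. Identify a pair $(i,j)$, $i<j$, with the positive root $\varepsilon_i-\varepsilon_j$ of $\mathfrak{gl}(n,K)$, and write $\gamma>\xi$ if $\gamma-\xi$ is a positive root (this is not an order relation). Let $S\subset M$ be the base of $M$, i.e. the unique subset such that $\gamma>\xi$ holds for no $\gamma,\xi\in S$ and every $\gamma\in M\setminus S$ satisfies $\gamma>\xi$ for some $\xi\in S$; explicitly, $S$ is obtained by repeatedly moving into $S$ the minimal elements of what remains of $M$ and discarding all elements greater than one of these. Let $\Phi$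 be the set of all pairs $(j,l)$ such that there are $(i,j)\in S$ and $(k,l)\in S$ with $j<k$ and with $j,k$ in the same block. Let $\Psi_1$ be the set of $(i,b)\in\Phi$ for which there are $j>i$ and $a<b$ with $(i,a),(j,a),(j,b)\in S\cup\Phi$. Let $\Psi_2$ be the set of those $\psi\in\Phi$ which are of the form $\psi=(R_{t-1}+k,\,R_t+1)$ with $1\le k<r_t$ and for which there is $s<t$ such that row $R_{s-1}+1$ contains at least $k$ elements of $\Phi$. Put $\Psi=\Psi_1\cup\Psi_2$ and $$\mathcal X=\Big\{\sum_{\psi\in\Psi}c_\psi E_\psi+\sum_{\xi\in(S\cup\Phi)\setminus\Psi}E_\xi\ :\ c_\psi\in K,\ c_\psi\ne0\text{ for all }\psi\in\Psi\Big\}.$$ Theorem. There is a nonempty Zariski-open set $U\subset\mathfrak m$ such that for every $x\in U$ there is $g\in B$ with $\mathrm{Ad}_g x\in\mathcal X$. -/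

import Mathlib

namespace BorelNilradical

open Matrix

/-! Throughout, a composition `c` of `n` is the list of sizes `(r₁, …, r_u)` of the diagonal blocks
of a standard parabolic subgroup `P ⊇ B` of `GL(n, K)`.  Rows and columns are numbered from `0` by
`Fin n`, blocks from `0` by `Fin c.length`; `c.index i` is the block containing `i`, and
`c.sizeUpTo k = r₁ + ⋯ + r_k` is the number `R_k`. -/

section Roots

variable {n : ℕ}

/-- The positive roots of `gl(n)`, as pairs `(i, j)` with `i < j`, standing for `ε_i - ε_j`. -/
def posRoots (n : ℕ) : Set (Fin n × Fin n) := {γ | γ.1 < γ.2}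

/-- The vector `ε_i - ε_j` of the pair `(i, j)`. -/
def rootVec (γ : Fin n × Fin n) : Fin n → ℤ := Pi.single γ.1 1 - Pi.single γ.2 1

/-- `RootLT ξ γ`: the relation `ξ < γ`, i.e. `γ - ξ` is a positive root.  Not an order. -/
def RootLT (ξ γ : Fin n × Fin n) : Prop := ∃ δ ∈ posRoots n, rootVec γ - rootVec ξ = rootVec δ

/-- On positive roots, `ξ < γ` says that `ξ` lies to the left of `γ` in the same row, or below `γ`
in the same column. -/
theorem rootLT_iff {ξ γ : Fin n × Fin n} (hξ : ξ ∈ posRoots n) (hγ : γ ∈ posRoots n) :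
    RootLT ξ γ ↔ (ξ.1 = γ.1 ∧ ξ.2 < γ.2) ∨ (ξ.2 = γ.2 ∧ γ.1 < ξ.1) := by
  obtain ⟨i, j⟩ := ξ
  obtain ⟨a, b⟩ := γ
  simp only [posRoots, Set.mem_ofPred_eq] at hξ hγ
  constructor
  · rintro ⟨⟨p, q⟩, hpq, h⟩
    simp only [posRoots, Set.mem_ofPred_eq] at hpq
    have hv : ∀ x : Fin n, ((if x = a then (1 : ℤ) else 0) - (if x = b then 1 else 0))
        - ((if x = i then 1 else 0) - (if x = j then 1 else 0))
        = (if x = p then 1 else 0) - (if x = q then 1 else 0) := by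
      intro x
      have := congrFun h x
      simpa only [rootVec, Pi.sub_apply, Pi.single_apply] using this
    have h1 := hv a
    have h2 := hv j
    have h3 := hv q
    have h4 := hv p
    have h5 := hv b
    clear h hv
    grind
  · rintro (⟨h1, h2⟩ | ⟨h1, h2⟩)
    · refine ⟨(j, b), h2, ?_⟩
      simp only at h1
      subst h1
      simp only [rootVec]
      abel
    · refine ⟨(a, i), h2, ?_⟩
      simp only at h1
      subst h1
      simp only [rootVec]
      abel

/-- The minimal elements of `A`: those `γ ∈ A` for which there is no `ξ ∈ A` with `ξ < γ`. -/
def minimalIn (A : Set (Fin n × Fin n)) : Set (Fin n × Fin n) :=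
  {γ | γ ∈ A ∧ ¬ ∃ ξ ∈ A, RootLT ξ γ}

/-- The set `M` of roots of the nilradical: the positions strictly above the diagonal blocks. -/
def nilRoots (c : Composition n) : Set (Fin n × Fin n) := {γ | c.index γ.1 < c.index γ.2}

/-- The positive roots of the block diagonal (reductive) part. -/
def leviPosRoots (c : Composition n) : Set (Fin n × Fin n) :=
  {γ | γ.1 < γ.2 ∧ c.index γ.1 = c.index γ.2}

/-- `S` is a base of `M`: its elements are pairwise incomparable, and each element of `M` outside `S`
is greater than some element of `S`. -/
def IsBase (c : Composition n) (S : Set (Fin n × Fin n)) : Prop :=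
  S ⊆ nilRoots c ∧ (∀ ξ ∈ S, ∀ ξ' ∈ S, ¬ RootLT ξ ξ') ∧
    ∀ γ ∈ nilRoots c, γ ∉ S → ∃ ξ ∈ S, RootLT ξ γ

/-- The sets `M = M₀ ⊇ M₁ ⊇ ⋯`: from `M_k` one removes its minimal elements and all elements greater
than one of these. -/
def remaining (c : Composition n) : ℕ → Set (Fin n × Fin n)
  | 0 => nilRoots c
  | k + 1 => remaining c k \ (minimalIn (remaining c k) ∪
      {γ | ∃ ξ ∈ minimalIn (remaining c k), RootLT ξ γ})

/-- The base `S`: the union of the sets of minimal elements of `M₀, M₁, …`. -/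
def base (c : Composition n) : Set (Fin n × Fin n) := ⋃ k, minimalIn (remaining c k)

theorem nilRoots_subset_posRoots (c : Composition n) : nilRoots c ⊆ posRoots n := by
  intro γ h
  have h1 : c.index γ.1 < c.index γ.2 := h
  have h2 : c.sizeUpTo ((c.index γ.1 : ℕ) + 1) ≤ c.sizeUpTo (c.index γ.2) :=
    c.monotone_sizeUpTo h1
  have h3 := c.lt_sizeUpTo_index_succ γ.1
  have h4 := c.sizeUpTo_index_le γ.2
  simp only [Fin.val_succ] at h3
  change γ.1 < γ.2
  omega

theorem height_lt {c : Composition n} {ξ γ : Fin n × Fin n} (hξ : ξ ∈ nilRoots c)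
    (hγ : γ ∈ nilRoots c) (h : RootLT ξ γ) :
    (ξ.2 : ℕ) - (ξ.1 : ℕ) < (γ.2 : ℕ) - (γ.1 : ℕ) := by
  have h1 := nilRoots_subset_posRoots c hξ
  have h2 := nilRoots_subset_posRoots c hγ
  rw [rootLT_iff h1 h2] at h
  simp only [posRoots, Set.mem_ofPred_eq] at h1 h2
  omega

theorem remaining_antitone (c : Composition n) : Antitone (remaining c) :=
  antitone_nat_of_succ_le fun _ => Set.sdiff_subset

/-- The algorithm does produce a base. -/
theorem base_isBase (c : Composition n) : IsBase c (base c) := by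
  have hsub : ∀ k, remaining c k ⊆ nilRoots c := fun k => remaining_antitone c (Nat.zero_le k)
  have hht : ∀ k, ∀ γ ∈ remaining c k, k < (γ.2 : ℕ) - (γ.1 : ℕ) := by
    intro k
    induction k with
    | zero =>
      intro γ h
      have : γ.1 < γ.2 := nilRoots_subset_posRoots c h
      omega
    | succ k ih =>
      intro γ h
      have h1 : ¬ γ ∈ minimalIn (remaining c k) := fun h' => h.2 (Or.inl h')
      have h2 : ∃ ξ ∈ remaining c k, RootLT ξ γ := by
        by_contra h3
        exact h1 ⟨h.1, h3⟩
      obtain ⟨ξ, hξ, hlt⟩ := h2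
      have := height_lt (hsub k hξ) (hsub k h.1) hlt
      have := ih ξ hξ
      omega
  refine ⟨?_, ?_, ?_⟩
  · intro γ h
    obtain ⟨k, hk⟩ := Set.mem_iUnion.1 h
    exact hsub k hk.1
  · intro ξ hξ ξ' hξ' hlt
    obtain ⟨k, hk⟩ := Set.mem_iUnion.1 hξ
    obtain ⟨l, hl⟩ := Set.mem_iUnion.1 hξ'
    rcases le_or_gt l k with h | h
    · exact hl.2 ⟨ξ, remaining_antitone c h hk.1, hlt⟩
    · have h1 : ξ' ∈ remaining c (k + 1) := remaining_antitone c h hl.1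
      exact h1.2 (Or.inr ⟨ξ, hk, hlt⟩)
  · intro γ hγ hS
    by_contra hno
    have hall : ∀ k, γ ∈ remaining c k := by
      intro k
      induction k with
      | zero => exact hγ
      | succ k ih =>
        refine ⟨ih, ?_⟩
        rintro (h | ⟨ξ, hξ, hlt⟩)
        · exact hS (Set.mem_iUnion.2 ⟨k, h⟩)
        · exact hno ⟨ξ, Set.mem_iUnion.2 ⟨k, hξ⟩, hlt⟩
    exact lt_irrefl _ (hht _ γ (hall _))

/-- The base is unique. -/
theorem IsBase.eq_base {c : Composition n} {S : Set (Fin n × Fin n)} (hS : IsBase c S) :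
    S = base c := by
  have hT := base_isBase c
  have key : ∀ m : ℕ, ∀ γ ∈ nilRoots c, (γ.2 : ℕ) - (γ.1 : ℕ) = m → (γ ∈ S ↔ γ ∈ base c) := by
    intro m
    induction m using Nat.strong_induction_on with
    | _ m ih =>
      intro γ hγ hm
      constructor
      · intro h
        by_contra h'
        obtain ⟨ξ, hξ, hlt⟩ := hT.2.2 γ hγ h'
        have hl := height_lt (hT.1 hξ) hγ hlt
        exact hS.2.1 ξ ((ih _ (hm ▸ hl) ξ (hT.1 hξ) rfl).2 hξ) γ h hlt
      · intro h
        by_contra h'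
        obtain ⟨ξ, hξ, hlt⟩ := hS.2.2 γ hγ h'
        have hl := height_lt (hS.1 hξ) hγ hlt
        exact hT.2.1 ξ ((ih _ (hm ▸ hl) ξ (hS.1 hξ) rfl).1 hξ) γ h hlt
  ext γ
  exact ⟨fun h => (key _ γ (hS.1 h) rfl).1 h, fun h => (key _ γ (hT.1 h) rfl).2 h⟩

/-- The set `Φ`: for each admissible pair `ξ = (i, j)`, `ξ' = (k, l)` of elements of `S`, i.e. with
`α = (j, k)` a positive root of the reductive part, it contains `α + ξ' = (j, l)`. -/
def phi (c : Composition n) : Set (Fin n × Fin n) :=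
  {φ | ∃ ξ ∈ base c, ∃ ξ' ∈ base c, (ξ.2, ξ'.1) ∈ leviPosRoots c ∧ φ = (ξ.2, ξ'.2)}

/-- The extended base `S ∪ Φ`. -/
def extBase (c : Composition n) : Set (Fin n × Fin n) := base c ∪ phi c

/-- The set `Ψ₁`: the `(i, b) ∈ Φ` such that `(i, a)`, `(j, a)`, `(j, b)` lie in `S ∪ Φ` for some
`i < j` and `a < b`. -/
def psiOne (c : Composition n) : Set (Fin n × Fin n) :=
  {ψ | ψ ∈ phi c ∧ ∃ j a : Fin n, ψ.1 < j ∧ a < ψ.2 ∧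
    (ψ.1, a) ∈ extBase c ∧ (j, a) ∈ extBase c ∧ (j, ψ.2) ∈ extBase c}

/-- The set `Ψ₂`: the `ψ ∈ Φ` lying in the `k`-th row of some block `t`, where `1 ≤ k < r_t`, and in
the first column after block `t`, such that for some block `s < t` the first row of block `s`
contains (at least) `k` elements of `Φ`. -/
def psiTwo (c : Composition n) : Set (Fin n × Fin n) :=
  {ψ | ψ ∈ phi c ∧ ∃ (t : Fin c.length) (k : ℕ), 1 ≤ k ∧ k < c.blocksFun t ∧
    (ψ.1 : ℕ) + 1 = c.sizeUpTo t + k ∧ (ψ.2 : ℕ) = c.sizeUpTo ((t : ℕ) + 1) ∧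
    ∃ s : Fin c.length, s < t ∧ ∃ i : Fin n, (i : ℕ) = c.sizeUpTo s ∧
      ∃ j : Fin k → Fin n, StrictMono j ∧ ∀ l, (i, j l) ∈ phi c}

/-- The set `Ψ = Ψ₁ ∪ Ψ₂`. -/
def psi (c : Composition n) : Set (Fin n × Fin n) := psiOne c ∪ psiTwo c

end Roots

section Groups

variable {n : ℕ}

/-- The Borel subgroup `B` of `GL(n, K)`: the invertible upper triangular matrices. -/
def borel (n : ℕ) (K : Type*) [Field K] : Subgroup (GL (Fin n) K) where
  carrier := {g | (g : Matrix (Fin n) (Fin n) K).BlockTriangular id}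
  mul_mem' := by
    intro a b ha hb
    simpa using BlockTriangular.mul ha hb
  one_mem' := by
    simpa using blockTriangular_one
  inv_mem' := by
    intro a ha
    have : Invertible (a : Matrix (Fin n) (Fin n) K) := a.invertible
    have h := blockTriangular_inv_of_blockTriangular (M := (a : Matrix (Fin n) (Fin n) K)) ha
    simpa using h

/-- The nilradical `𝔪`: the matrices supported strictly above the diagonal blocks. -/
def nilradical (K : Type*) [Field K] (c : Composition n) :
    Submodule K (Matrix (Fin n) (Fin n) K) where
  carrier := {x | ∀ i j, (i, j) ∉ nilRoots c → x i j = 0}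
  add_mem' := by
    intro x y hx hy i j h
    simp [hx i j h, hy i j h]
  zero_mem' := by
    intro i j _
    rfl
  smul_mem' := by
    intro a x hx i j h
    simp [hx i j h]

/-- The coordinates `x_γ`, `γ ∈ M`, of an element of `𝔪`. -/
def coords {K : Type*} [Field K] (c : Composition n) (x : nilradical K c) : nilRoots c → K :=
  fun γ => (x : Matrix (Fin n) (Fin n) K) γ.1.1 γ.1.2

/-- A subset of `𝔪` is Zariski open when its complement is the zero set of an ideal of
`K[𝔪] = K[x_γ : γ ∈ M]`. -/
def IsZariskiOpen {K : Type*} [Field K] (c : Composition n) (U : Set (nilradical K c)) : Prop :=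
  ∃ I : Ideal (MvPolynomial (nilRoots c) K), U = {x | coords c x ∉ MvPolynomial.zeroLocus K I}

/-- The set `𝒳` of all matrices `∑_{ψ ∈ Ψ} c_ψ E_ψ + ∑_{ξ ∈ (S ∪ Φ) \ Ψ} E_ξ` with all `c_ψ ≠ 0`. -/
def canonicalSet (K : Type*) [Field K] (c : Composition n) : Set (Matrix (Fin n) (Fin n) K) :=
  {x | ∀ i j, ((i, j) ∈ psi c → x i j ≠ 0) ∧
    ((i, j) ∈ extBase c \ psi c → x i j = 1) ∧
    ((i, j) ∉ extBase c → x i j = 0)}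

end Groups

end BorelNilradical

/-! Let `L` be the fraction field of `K[𝔪]` and `x` the matrix of coordinate functions. A normal
form of `x` over `L` specialises, once denominators are cleared, to all points of a nonempty open
set (`exists_zariskiOpen_normal_form`), so it suffices to bring this one generic matrix to a matrix
`y` whose nonzero entries are exactly those in `S ∪ Φ`, and then to scale.

The normal form is built one diagonal block at a time (`exists_normal_extension`). Let `y` be the
normal form of the earlier blocks and `z` the columns of the new one. Conjugation by a unipotent
matrix changes `z` by any `y * v`, so only the class of `z` in the cokernel of `y` matters. The
cokernel has dimension `m`, the largest size of a block so far, and a basis given by the rows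
without an element of `S`. Thus `z` becomes an `m × r` matrix, which may be multiplied on the right
by upper triangular `V` and on the left by `1 + T`, where `T` is induced by a strictly upper
triangular matrix commuting with `y`. Since the new columns are algebraically independent over the
field generated by the earlier ones, the relevant minors do not vanish. The matrix is therefore `Lo
* V` with `Lo` lower triangular and nonzero on and below the diagonal. The `T` at hand clear the
positions `Kill`, and what survives is exactly `S ∪ Φ` (`Blocks.Normal.extend`).

The induction has to know how the centraliser of `y` acts on the cokernel. `RowState` records the
action of its strictly upper triangular part. To extend it, the entries between old and new blocks
of a commuting matrix must be adjustable at will. The correction is `θ` times the new matrix, for a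
`θ` commuting with `y` in the whole parabolic algebra; it is strictly upper triangular because `y`
is in the nilradical. That enough such `θ` exist (`exists_commute_lift`) is what `BlockState`
provides: in suitable coordinates all lower triangular matrices are induced.

Finally, the positions in `(S ∪ Φ) \ Ψ`, read as edges on the set of indices, form a forest
(`exists_leaf`), so a diagonal matrix makes all entries there equal to `1`. -/

namespace BorelNilradical

open Matrix

set_option linter.unusedSectionVars false

/-! ### Cokernels with coordinates, and the action of commuting matrices on them -/

section Cokernel

variable {F : Type*} [Field F] {ι κ : Type*} [Fintype ι] [DecidableEq ι] [Fintype κ]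
  [DecidableEq κ] {N : ℕ}

/-- The projection of `F^N` onto the span of the first `m` standard basis vectors. -/
def levelProj (N : ℕ) (F : Type*) [Field F] (m : ℕ) : Matrix (Fin N) (Fin N) F :=
  diagonal fun b => if (b : ℕ) < m then 1 else 0

theorem levelProj_mul_apply (m : ℕ) {κ' : Type*} (A : Matrix (Fin N) κ' F) (b : Fin N)
    (k : κ') :
    (levelProj N F m * A) b k = if (b : ℕ) < m then A b k else 0 := by
  simp [levelProj, diagonal_mul]

theorem mul_levelProj_apply (m : ℕ) {κ' : Type*} (A : Matrix κ' (Fin N) F) (b : Fin N)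
    (k : κ') :
    (A * levelProj N F m) k b = if (b : ℕ) < m then A k b else 0 := by
  simp [levelProj, mul_diagonal]

theorem levelProj_mul_self (m : ℕ) : levelProj N F m * levelProj N F m = levelProj N F m := by
  ext a b
  rw [levelProj_mul_apply]
  simp only [levelProj, diagonal_apply]
  split_ifs <;> rfl

/-- The surjection `π` onto the first `m` coordinates, with section `τ`, is a cokernel of `x`. -/
structure IsCokernel (x : Matrix ι ι F) (m : ℕ) (π : Matrix (Fin N) ι F)
    (τ : Matrix ι (Fin N) F) : Prop where
  mul_eq_zero : π * x = 0
  split : ∃ s : Matrix ι ι F, x * s + τ * π = 1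
  proj : π * τ = levelProj N F m

theorem IsCokernel.levelProj_mul {x : Matrix ι ι F} {m : ℕ} {π : Matrix (Fin N) ι F}
    {τ : Matrix ι (Fin N) F} (h : IsCokernel x m π τ) : levelProj N F m * π = π := by
  obtain ⟨s, hs⟩ := h.split
  calc levelProj N F m * π = π * (x * s + τ * π) := by
        rw [Matrix.mul_add, ← Matrix.mul_assoc, ← Matrix.mul_assoc, h.mul_eq_zero, h.proj,
          Matrix.zero_mul, zero_add]
    _ = π := by rw [hs, Matrix.mul_one]

theorem IsCokernel.exists_eq_mul {x : Matrix ι ι F} {m : ℕ} {π : Matrix (Fin N) ι F}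
    {τ : Matrix ι (Fin N) F} (h : IsCokernel x m π τ) {Y : Matrix ι κ F} (hY : π * Y = 0) :
    ∃ U : Matrix ι κ F, Y = x * U := by
  obtain ⟨s, hs⟩ := h.split
  refine ⟨s * Y, ?_⟩
  calc Y = (x * s + τ * π) * Y := by rw [hs, Matrix.one_mul]
    _ = x * (s * Y) := by
      rw [Matrix.add_mul, Matrix.mul_assoc, Matrix.mul_assoc, hY, Matrix.mul_zero, add_zero]

/-- `w` inverts `c` on the first `min m r` coordinates. -/
structure QuasiInverse (m r : ℕ) (c : Matrix (Fin N) κ F) (w : Matrix κ (Fin N) F) : Prop where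
  regular : c * w * c = c
  levelProj_mul : levelProj N F r * (levelProj N F m - c * w) = 0
  mul_levelProj : w * levelProj N F r = w
  mul_levelProj' : w * levelProj N F m = w
  eq_zero_or : levelProj N F m - c * w = 0 ∨ w * c = 1

/-- Data that turn a cokernel of `x` into one of `fromBlocks x z 0 0`, where `c` is the matrix of
`z` modulo `x`. -/
structure Adapted (m r : ℕ) (c : Matrix (Fin N) κ F) (w : Matrix κ (Fin N) F)
    (Z : Matrix (Fin N) κ F) (Z' : Matrix κ (Fin N) F) : Prop extends QuasiInverse m r c w where
  left_inv : Z' * Z = 1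
  right_inv : Z * Z' = levelProj N F r

variable {m r : ℕ} {c : Matrix (Fin N) κ F} {w : Matrix κ (Fin N) F}
    {Z : Matrix (Fin N) κ F} {Z' : Matrix κ (Fin N) F}

theorem Adapted.levelProj_mul_right (h : Adapted m r c w Z Z') : levelProj N F r * Z = Z := by
  rw [← h.right_inv, Matrix.mul_assoc, h.left_inv, Matrix.mul_one]

theorem Adapted.mul_levelProj_left (h : Adapted m r c w Z Z') : Z' * levelProj N F r = Z' := by
  rw [← h.right_inv, ← Matrix.mul_assoc, h.left_inv, Matrix.one_mul]

theorem levelProj_max (m r : ℕ) : levelProj N F m * (1 - levelProj N F r) + levelProj N F r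
    = levelProj N F (max m r) := by
  ext a b
  simp only [levelProj, Matrix.add_apply, diagonal_mul, Matrix.sub_apply, Matrix.one_apply,
    diagonal_apply, lt_max_iff]
  by_cases h : a = b
  · subst h
    by_cases h1 : (a : ℕ) < m <;> by_cases h2 : (a : ℕ) < r <;> simp [h1, h2]
  · simp [h]

/-- The cokernel of the enlarged matrix is the old cokernel modulo the image of `z`, plus the span
of the new block. The projection `levelProj N F m - π * z * w` kills the image of `z` and takes
values in the coordinates from `r` on, so the new block can occupy the first `r` coordinates. -/
theorem IsCokernel.fromBlocks {x : Matrix ι ι F} {π : Matrix (Fin N) ι F}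
    {τ : Matrix ι (Fin N) F} (h : IsCokernel x m π τ) {z : Matrix ι κ F}
    (hA : Adapted m r (π * z) w Z Z') :
    IsCokernel (fromBlocks x z 0 0) (max m r)
      (fromCols ((levelProj N F m - π * z * w) * π) Z)
      (fromRows (τ * (1 - levelProj N F r)) Z') := by
  obtain ⟨s, hs⟩ := h.split
  have hP := h.levelProj_mul
  refine ⟨?_, ⟨Matrix.fromBlocks (s - s * (z * w * π)) 0 (w * π) 0, ?_⟩, ?_⟩
  · rw [fromCols_mul_fromBlocks, Matrix.mul_assoc, h.mul_eq_zero, Matrix.mul_assoc _ π z,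
      Matrix.sub_mul _ _ (π * z), ← Matrix.mul_assoc (levelProj N F m), hP, hA.regular]
    simp
  · rw [fromBlocks_multiply, fromRows_mul_fromCols, fromBlocks_add, ← fromBlocks_one]
    have hx : x * s = 1 - τ * π := by rw [← hs]; abel
    have h1 : (1 - levelProj N F r) * (levelProj N F m - π * z * w)
        = levelProj N F m - π * z * w := by
      rw [Matrix.sub_mul, hA.levelProj_mul, Matrix.one_mul, sub_zero]
    congr 1
    · have h2 : τ * (1 - levelProj N F r) * ((levelProj N F m - π * z * w) * π)
          = τ * (π - π * (z * w * π)) := by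
        rw [Matrix.mul_assoc, ← Matrix.mul_assoc (1 - levelProj N F r), h1, Matrix.sub_mul, hP]
        simp only [Matrix.mul_assoc]
      rw [h2, Matrix.mul_sub, ← Matrix.mul_assoc, hx]
      simp only [Matrix.mul_assoc, Matrix.mul_sub, Matrix.sub_mul, Matrix.one_mul]
      abel
    · rw [Matrix.mul_assoc, Matrix.sub_mul, hA.levelProj_mul_right]
      simp
    · rw [← hA.mul_levelProj_left, Matrix.mul_assoc Z', ← Matrix.mul_assoc (levelProj N F r) _ π,
        hA.levelProj_mul]
      simp
    · simp [hA.left_inv]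
  · rw [fromCols_mul_fromRows, hA.right_inv, ← levelProj_max, ← Matrix.mul_assoc,
      Matrix.mul_assoc _ π τ, h.proj]
    congr 1
    rw [Matrix.sub_mul, levelProj_mul_self, Matrix.mul_assoc (π * z), hA.mul_levelProj', Matrix.sub_mul _ _ (1 - _),
      Matrix.mul_assoc (π * z), Matrix.mul_sub w, hA.mul_levelProj]
    simp

/-- The matrix `T` on the cokernel `π` of `x` is induced by an element of `U` commuting with `x`. -/
def Realizes (U : Submodule F (Matrix ι ι F)) (x : Matrix ι ι F) (π : Matrix (Fin N) ι F)
    (T : Matrix (Fin N) (Fin N) F) : Prop :=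
  ∃ θ ∈ U, θ * x = x * θ ∧ π * θ = T * π

theorem Realizes.zero (U : Submodule F (Matrix ι ι F)) (x : Matrix ι ι F)
    (π : Matrix (Fin N) ι F) : Realizes U x π 0 :=
  ⟨0, U.zero_mem, by simp, by simp⟩

theorem Realizes.add {U : Submodule F (Matrix ι ι F)} {x : Matrix ι ι F}
    {π : Matrix (Fin N) ι F} {S T : Matrix (Fin N) (Fin N) F} (hS : Realizes U x π S)
    (hT : Realizes U x π T) : Realizes U x π (S + T) := by
  obtain ⟨θ, h1, h2, h3⟩ := hS
  obtain ⟨η, h4, h5, h6⟩ := hT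
  exact ⟨θ + η, U.add_mem h1 h4, by rw [Matrix.add_mul, Matrix.mul_add, h2, h5],
    by rw [Matrix.add_mul, Matrix.mul_add, h3, h6]⟩

theorem Realizes.smul {U : Submodule F (Matrix ι ι F)} {x : Matrix ι ι F}
    {π : Matrix (Fin N) ι F} {S : Matrix (Fin N) (Fin N) F} (a : F) (hS : Realizes U x π S) :
    Realizes U x π (a • S) := by
  obtain ⟨θ, h1, h2, h3⟩ := hS
  exact ⟨a • θ, U.smul_mem a h1, by simp [h2], by simp [h3]⟩

theorem realizes_of_single {U : Submodule F (Matrix ι ι F)} {x : Matrix ι ι F}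
    {π : Matrix (Fin N) ι F} {T : Matrix (Fin N) (Fin N) F}
    (h : ∀ b a, T b a ≠ 0 → Realizes U x π (single b a 1)) : Realizes U x π T := by
  rw [matrix_eq_sum_single T]
  refine Finset.sum_induction _ _ (fun _ _ => Realizes.add) (Realizes.zero ..) fun b _ => ?_
  refine Finset.sum_induction _ _ (fun _ _ => Realizes.add) (Realizes.zero ..) fun a _ => ?_
  by_cases hT : T b a = 0
  · rw [hT, single_zero]
    exact Realizes.zero ..
  · have := (h b a hT).smul (T b a)
    rwa [smul_single, smul_eq_mul, mul_one] at this

/-- Every map from the new block to `ι` is, modulo `x` and `z`, the restriction of an element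
commuting with `x`. -/
theorem exists_commute_lift {U : Submodule F (Matrix ι ι F)} {x : Matrix ι ι F}
    {σ : Matrix (Fin N) ι F} {τ : Matrix ι (Fin N) F} (h : IsCokernel x m σ τ) {z : Matrix ι κ F}
    (hA : Adapted m r (σ * z) w Z Z')
    (hU : ∀ b a : Fin N, a ≤ b → (b : ℕ) < m → Realizes U x σ (single b a 1))
    (Y : Matrix ι κ F) :
    ∃ θ ∈ U, θ * x = x * θ ∧ ∃ (V : Matrix ι κ F) (W : Matrix κ κ F), θ * z = Y + x * V + z * W := by
  set Λ := levelProj N F m - σ * z * w with hΛ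
  have hP := h.levelProj_mul
  -- This operator is lower triangular: `w` reads only coordinates below `r`, while `Λ` has values
  -- only in those from `r` on. As `w` is a left inverse of `σ * z` unless `Λ = 0`, it makes `θ * z
  -- - Y` vanish under `Λ * σ`, hence lie in the span of the images of `x` and `z`.
  obtain ⟨θ, h1, h2, h3⟩ : Realizes U x σ (Λ * (σ * Y * w)) := by
    refine realizes_of_single fun b a hba => ?_
    have hbr : r ≤ (b : ℕ) := by
      by_contra hlt
      apply hba
      have h0 : levelProj N F r * (Λ * (σ * Y * w)) = 0 := by
        rw [← Matrix.mul_assoc, hΛ, hA.levelProj_mul, Matrix.zero_mul]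
      have := levelProj_mul_apply r (Λ * (σ * Y * w)) b a
      rwa [h0, if_pos (by omega), Matrix.zero_apply, eq_comm] at this
    have hbm : (b : ℕ) < m := by
      by_contra hlt
      apply hba
      have : levelProj N F m * Λ = Λ := by
        rw [hΛ, Matrix.mul_sub, ← Matrix.mul_assoc, ← Matrix.mul_assoc, hP]
        rw [levelProj_mul_self]
      rw [← this, Matrix.mul_assoc, levelProj_mul_apply, if_neg (by omega)]
    have har : (a : ℕ) < r := by
      by_contra hlt
      apply hba
      rw [← hA.mul_levelProj, ← Matrix.mul_assoc, ← Matrix.mul_assoc, mul_levelProj_apply,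
        if_neg (by omega)]
    exact hU b a (Fin.le_def.2 (by omega)) hbm
  refine ⟨θ, h1, h2, ?_⟩
  have h4 : Λ * σ * (θ * z - Y) = 0 := by
    have h5 : Λ * Λ = Λ := by
      nth_rw 2 [hΛ]
      rw [Matrix.mul_sub, ← Matrix.mul_assoc Λ, show Λ * (σ * z) = 0 by
        rw [hΛ, Matrix.sub_mul, ← Matrix.mul_assoc, hP, hA.regular, sub_self], Matrix.zero_mul,
        sub_zero, hΛ, Matrix.sub_mul, Matrix.mul_assoc _ w, hA.mul_levelProj']
      rw [levelProj_mul_self]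
    have h6 : Λ * σ * (θ * z) = Λ * (σ * Y) * (w * (σ * z)) := by
      rw [Matrix.mul_assoc, ← Matrix.mul_assoc σ, h3]
      simp only [Matrix.mul_assoc]
      rw [← Matrix.mul_assoc Λ Λ, h5]
    rw [Matrix.mul_sub, h6]
    rcases hA.eq_zero_or with h0 | h0
    · rw [hΛ, h0]; simp
    · rw [h0, Matrix.mul_one, Matrix.mul_assoc, sub_self]
  obtain ⟨V, hV⟩ := h.exists_eq_mul
    (Y := θ * z - Y - z * (w * σ * (θ * z - Y))) (by
      rw [hΛ, Matrix.sub_mul, hP, Matrix.sub_mul] at h4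
      rw [Matrix.mul_sub, ← h4]
      simp only [Matrix.mul_assoc])
  exact ⟨V, _, by rw [← hV]; abel⟩

/-- Extension of an element commuting with `x` to one commuting with `fromBlocks x z 0 0`. -/
theorem exists_commute_extension {U : Submodule F (Matrix ι ι F)}
    {U' : Submodule F (Matrix (ι ⊕ κ) (ι ⊕ κ) F)} {x : Matrix ι ι F} {z : Matrix ι κ F}
    (hx : ∀ θ ∈ U, ∀ Y, fromBlocks (θ * x) Y 0 0 ∈ U')
    (hlift : ∀ Y : Matrix ι κ F, ∃ θ ∈ U, θ * x = x * θ ∧ ∃ (V : Matrix ι κ F) (W : Matrix κ κ F), θ * z = Y + x * V + z * W)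
    {π : Matrix (Fin N) ι F} {τ : Matrix ι (Fin N) F} (h : IsCokernel x m π τ)
    {Λ : Matrix (Fin N) (Fin N) F} (hΛ : Λ * (π * z) = 0)
    {θ : Matrix ι ι F} (hθ : θ * x = x * θ) {w₀ : Matrix κ κ F} (hw : π * (θ * z - z * w₀) = 0)
    (hU' : ∀ Y, fromBlocks θ Y 0 w₀ ∈ U') (Y : Matrix ι κ F) :
    ∃ Θ ∈ U', Θ * fromBlocks x z 0 0 = fromBlocks x z 0 0 * Θ ∧
      fromCols (Λ * π) Z * Θ = fromCols (Λ * π * θ) (Z * w₀ + Λ * (π * Y)) := by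
  obtain ⟨v, hv⟩ := h.exists_eq_mul hw
  obtain ⟨η, h1, h2, V, W, h3⟩ := hlift (v - Y)
  -- The subtracted matrix is `η`, extended by zero, times the enlarged matrix; it commutes with the
  -- latter because `η` commutes with `x`. On the new cokernel its only effect is to replace `v` by
  -- the prescribed `Y`.
  refine ⟨fromBlocks θ v 0 w₀ - fromBlocks (η * x) (η * z) 0 0,
    U'.sub_mem (hU' v) (hx η h1 _), ?_, ?_⟩
  · rw [Matrix.sub_mul, Matrix.mul_sub]
    simp only [fromBlocks_multiply, Matrix.zero_mul, Matrix.mul_zero, add_zero]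
    rw [← hv, hθ, sub_add_cancel, Matrix.mul_assoc η, ← Matrix.mul_assoc x η z, ← h2,
      Matrix.mul_assoc η, ← Matrix.mul_assoc x η, ← h2, Matrix.mul_assoc η]
  · rw [Matrix.mul_sub]
    simp only [fromCols_mul_fromBlocks, Matrix.mul_zero, add_zero]
    have h4 : Λ * π * (η * x) = 0 := by
      rw [h2, Matrix.mul_assoc, ← Matrix.mul_assoc π, h.mul_eq_zero, Matrix.zero_mul,
        Matrix.mul_zero]
    have h5 : Λ * π * (η * z) = Λ * π * v - Λ * (π * Y) := by
      rw [h3, Matrix.mul_add, Matrix.mul_add, Matrix.mul_assoc Λ π (x * V), ← Matrix.mul_assoc π x,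
        h.mul_eq_zero, Matrix.mul_assoc Λ π (z * W), ← Matrix.mul_assoc π z,
        ← Matrix.mul_assoc Λ (π * z), hΛ, Matrix.mul_sub, Matrix.mul_assoc Λ π Y]
      simp
    rw [h4, h5]
    ext i (j | j) <;> simp

end Cokernel

/-! ### Construction of quasi-inverses and adapted coordinates -/

section Inclusion

variable {F : Type*} [Field F]

/-- The inclusion of `F^q` into `F^n` as the first `q` coordinates. -/
def inclMatrix (F : Type*) [Field F] {q n : ℕ} (h : q ≤ n) : Matrix (Fin n) (Fin q) F :=
  (1 : Matrix (Fin n) (Fin n) F).submatrix id (Fin.castLE h)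

theorem mul_inclMatrix {q n : ℕ} (h : q ≤ n) {κ : Type*} (A : Matrix κ (Fin n) F) :
    A * inclMatrix F h = A.submatrix id (Fin.castLE h) := by
  ext i j
  simp [inclMatrix, Matrix.mul_apply, Matrix.one_apply]

theorem inclMatrix_transpose_mul {q n : ℕ} (h : q ≤ n) {κ : Type*} (A : Matrix (Fin n) κ F) :
    (inclMatrix F h)ᵀ * A = A.submatrix (Fin.castLE h) id := by
  ext i j
  simp [inclMatrix, Matrix.mul_apply, Matrix.one_apply]

theorem inclMatrix_transpose_mul_self {q n : ℕ} (h : q ≤ n) :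
    (inclMatrix F h)ᵀ * inclMatrix F h = 1 := by
  rw [inclMatrix_transpose_mul]
  ext i j
  simp [inclMatrix, Matrix.one_apply]

theorem inclMatrix_mul_transpose {q n : ℕ} (h : q ≤ n) :
    inclMatrix F h * (inclMatrix F h)ᵀ = levelProj n F q := by
  ext i j
  simp only [inclMatrix, Matrix.mul_apply, Matrix.one_apply, submatrix_apply, transpose_apply,
    id, levelProj, diagonal_apply]
  by_cases hi : (i : ℕ) < q
  · rw [Finset.sum_eq_single ⟨i, hi⟩]
    · have : Fin.castLE h ⟨i, hi⟩ = i := rfl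
      rw [this]
      by_cases hij : i = j
      · subst hij; simp [hi]
      · rw [if_neg hij, if_neg (Ne.symm hij)]; simp
    · intro b _ hb
      rw [if_neg (fun h' : i = Fin.castLE h b => hb (Fin.ext (congrArg Fin.val h').symm)), zero_mul]
    · simp
  · rw [Finset.sum_eq_zero fun b _ => ?_]
    · simp [hi]
    · rw [if_neg (fun h' => hi (by rw [h']; exact b.2)), zero_mul]

theorem levelProj_mul_levelProj {N : ℕ} (m r : ℕ) :
    levelProj N F r * levelProj N F m = levelProj N F (min m r) := by
  ext a b
  rw [levelProj_mul_apply]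
  simp only [levelProj, diagonal_apply, lt_min_iff]
  by_cases h : a = b
  · subst h
    by_cases h1 : (a : ℕ) < m <;> by_cases h2 : (a : ℕ) < r <;> simp [h1, h2]
  · simp [h]

theorem levelProj_eq_one {N m : ℕ} (h : N ≤ m) : levelProj N F m = 1 := by
  ext a b
  have : (a : ℕ) < m := by omega
  simp [levelProj, diagonal_apply, this, Matrix.one_apply]

/-- The inverse of the leading square block of size `min m r`, padded by zeros, serves as `w`. For
`m ≤ r` it is a right inverse on the first `m` coordinates, for `r ≤ m` a left inverse. -/
theorem exists_quasiInverse {N m r : ℕ} (hm : m ≤ N) {c : Matrix (Fin N) (Fin r) F}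
    (hc : levelProj N F m * c = c)
    (hdet : (c.submatrix (Fin.castLE ((min_le_left m r).trans hm))
      (Fin.castLE (min_le_right m r))).det ≠ 0) :
    ∃ w, QuasiInverse m r c w ∧ levelProj r F m * w = w := by
  set η : Matrix (Fin N) (Fin (min m r)) F := inclMatrix F ((min_le_left m r).trans hm) with hη
  set ρ : Matrix (Fin r) (Fin (min m r)) F := inclMatrix F (min_le_right m r) with hρ
  have hA : c.submatrix (Fin.castLE ((min_le_left m r).trans hm))
      (Fin.castLE (min_le_right m r)) = ηᵀ * c * ρ := by
    rw [hη, hρ, inclMatrix_transpose_mul, mul_inclMatrix, submatrix_submatrix]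
    rfl
  rw [hA] at hdet
  set A := ηᵀ * c * ρ with hAdef
  have hu : IsUnit A.det := isUnit_iff_ne_zero.2 hdet
  have hAi : A * A⁻¹ = 1 := mul_nonsing_inv A hu
  have hiA : A⁻¹ * A = 1 := nonsing_inv_mul A hu
  have hηη : η * ηᵀ = levelProj N F (min m r) := inclMatrix_mul_transpose _
  have hρρ : ρ * ρᵀ = levelProj r F (min m r) := inclMatrix_mul_transpose _
  have hηη' : ηᵀ * η = 1 := inclMatrix_transpose_mul_self _
  have hρρ' : ρᵀ * ρ = 1 := inclMatrix_transpose_mul_self _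
  have hηT : ∀ s, min m r ≤ s → ηᵀ * levelProj N F s = ηᵀ := by
    intro s hs
    have h1 : ηᵀ * levelProj N F (min m r) = ηᵀ := by
      rw [← hηη, ← Matrix.mul_assoc, hηη', Matrix.one_mul]
    calc ηᵀ * levelProj N F s = ηᵀ * levelProj N F (min m r) * levelProj N F s := by rw [h1]
      _ = ηᵀ := by rw [Matrix.mul_assoc, levelProj_mul_levelProj, min_eq_right hs, h1]
  have hρT : ∀ s, min m r ≤ s → levelProj r F s * ρ = ρ := by
    intro s hs
    have h1 : levelProj r F (min m r) * ρ = ρ := by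
      rw [← hρρ, Matrix.mul_assoc, hρρ', Matrix.mul_one]
    calc levelProj r F s * ρ = levelProj r F s * (levelProj r F (min m r) * ρ) := by rw [h1]
      _ = ρ := by rw [← Matrix.mul_assoc, levelProj_mul_levelProj, min_eq_left hs, h1]
  have hkey : levelProj N F (min m r) * c * (ρ * A⁻¹ * ηᵀ) = levelProj N F (min m r) := by
    rw [← hηη]
    calc η * ηᵀ * c * (ρ * A⁻¹ * ηᵀ) = η * ((ηᵀ * c * ρ) * A⁻¹) * ηᵀ := by
          simp only [Matrix.mul_assoc]
      _ = η * ηᵀ := by rw [← hAdef, hAi, Matrix.mul_one]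
  have hcase : levelProj N F m - c * (ρ * A⁻¹ * ηᵀ) = 0 ∨ (ρ * A⁻¹ * ηᵀ) * c = 1 := by
    rcases le_total m r with h | h
    · left
      have h1 : levelProj N F (min m r) = levelProj N F m := by rw [min_eq_left h]
      rw [h1, hc] at hkey
      rw [hkey, sub_self]
    · right
      have h1 : ρ * ρᵀ = 1 := by rw [hρρ, levelProj_eq_one (by simp [h])]
      calc ρ * A⁻¹ * ηᵀ * c = ρ * (A⁻¹ * (ηᵀ * c * (ρ * ρᵀ))) := by
            rw [h1, Matrix.mul_one]; simp only [Matrix.mul_assoc]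
        _ = ρ * (A⁻¹ * A * ρᵀ) := by rw [hAdef]; simp only [Matrix.mul_assoc]
        _ = 1 := by rw [hiA, Matrix.one_mul, h1]
  refine ⟨ρ * A⁻¹ * ηᵀ, ⟨?_, ?_, ?_, ?_, hcase⟩, ?_⟩
  · rcases hcase with h | h
    · rw [← sub_eq_zero.1 h, hc]
    · rw [Matrix.mul_assoc, h, Matrix.mul_one]
  · have h1 : levelProj N F r * (c * (ρ * A⁻¹ * ηᵀ)) = levelProj N F (min m r) := by
      rw [← hkey, ← levelProj_mul_levelProj, Matrix.mul_assoc _ _ c, hc,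
        Matrix.mul_assoc (levelProj N F r) c]
    rw [Matrix.mul_sub, levelProj_mul_levelProj, h1, sub_self]
  · rw [Matrix.mul_assoc, hηT _ (min_le_right _ _)]
  · rw [Matrix.mul_assoc, hηT _ (min_le_left _ _)]
  · rw [← Matrix.mul_assoc, ← Matrix.mul_assoc, hρT _ (min_le_left _ _)]

/-- The completion of the first rows of `c` to an invertible matrix. -/
theorem QuasiInverse.exists_adapted {N m r : ℕ} (hr : r ≤ N) {c : Matrix (Fin N) (Fin r) F}
    {w : Matrix (Fin r) (Fin N) F} (h : QuasiInverse m r c w) (hw : levelProj r F m * w = w) :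
    ∃ Z Z', Adapted m r c w Z Z' ∧ c * Z' = c * w ∧
      ∀ a : Fin N, (a : ℕ) < m → (a : ℕ) < r → ∀ p, Z a p = c a p := by
  set η : Matrix (Fin N) (Fin r) F := inclMatrix F hr with hη
  have hηη : η * ηᵀ = levelProj N F r := inclMatrix_mul_transpose _
  have hηη' : ηᵀ * η = 1 := inclMatrix_transpose_mul_self _
  have hwη : w * η * ηᵀ = w := by rw [Matrix.mul_assoc, hηη, h.mul_levelProj]
  set Q : Matrix (Fin r) (Fin r) F := 1 - levelProj r F m with hQ
  have hcw : levelProj N F r * (c * w) = levelProj N F r * levelProj N F m := by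
    have := h.levelProj_mul
    rw [Matrix.mul_sub, sub_eq_zero] at this
    exact this.symm
  have hcw' : ηᵀ * (c * w) = ηᵀ * levelProj N F m := by
    have := congrArg (ηᵀ * ·) hcw
    simp only [← hηη] at this
    simpa only [← Matrix.mul_assoc, hηη', Matrix.one_mul] using this
  have h1 : ηᵀ * levelProj N F m * η = levelProj r F m := by
    rw [hη, inclMatrix_transpose_mul, mul_inclMatrix]
    ext a b
    simp [levelProj, diagonal_apply]
  have hcwc : c * (w * c) = c := by rw [← Matrix.mul_assoc, h.regular]
  have hcwc' : c * (1 - w * c) = 0 := by rw [Matrix.mul_sub, hcwc, Matrix.mul_one, sub_self]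
  have hQw : Q * w = 0 := by rw [hQ, Matrix.sub_mul, hw, Matrix.one_mul, sub_self]
  -- `Q` puts ones on the diagonal in the positions from `m` on, which supplies the rows lacking
  -- when `m < r`.
  set B := ηᵀ * c + Q with hB
  set B' := w * η + (1 - w * c) * Q with hB'
  have hBB' : B * B' = 1 := by
    rw [hB, hB', Matrix.add_mul, Matrix.mul_add, Matrix.mul_add, ← Matrix.mul_assoc Q w, hQw,
      ← Matrix.mul_assoc (ηᵀ * c), Matrix.mul_assoc ηᵀ c w, hcw', h1,
      ← Matrix.mul_assoc (ηᵀ * c), Matrix.mul_assoc ηᵀ c (1 - _), hcwc',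
      ← Matrix.mul_assoc Q (1 - _), Matrix.mul_sub Q 1 (w * c), ← Matrix.mul_assoc Q w c, hQw]
    have : Q * Q = Q := by
      rw [hQ]
      simp [Matrix.mul_sub, Matrix.sub_mul, levelProj_mul_self]
    simp only [Matrix.zero_mul, Matrix.mul_zero, Matrix.mul_one, sub_zero, zero_add, add_zero, this]
    rw [hQ]
    abel
  have hB'B : B' * B = 1 := mul_eq_one_comm.1 hBB'
  refine ⟨η * B, B' * ηᵀ, ⟨h, ?_, ?_⟩, ?_, ?_⟩
  · rw [Matrix.mul_assoc, ← Matrix.mul_assoc ηᵀ, hηη', Matrix.one_mul, hB'B]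
  · rw [Matrix.mul_assoc, ← Matrix.mul_assoc B, hBB', Matrix.one_mul, hηη]
  · rw [hB', Matrix.add_mul, hwη, Matrix.mul_add, Matrix.mul_assoc _ Q,
      ← Matrix.mul_assoc c, hcwc']
    simp
  · intro a ham har p
    have h2 : ∀ X : Matrix (Fin r) (Fin r) F, (η * X) a p = X ⟨a, har⟩ p := by
      intro X
      have h3 : (ηᵀ * (η * X)) ⟨a, har⟩ p = (η * X) a p := by
        rw [hη, inclMatrix_transpose_mul]
        rfl
      rw [← h3, ← Matrix.mul_assoc, hηη', Matrix.one_mul]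
    rw [h2, hB, Matrix.add_apply, hη, inclMatrix_transpose_mul, hQ, Matrix.sub_apply]
    simp [levelProj, diagonal_apply, Matrix.one_apply, ham]

/-- The first `r` coordinates in reverse order. -/
def revMatrix (F : Type*) [Field F] {r N : ℕ} (h : r ≤ N) : Matrix (Fin N) (Fin r) F :=
  (inclMatrix F h).submatrix id Fin.rev

theorem revMatrix_apply {r N : ℕ} (h : r ≤ N) (b : Fin N) (p : Fin r) :
    revMatrix F h b p = if (b : ℕ) + p + 1 = r then 1 else 0 := by
  simp only [revMatrix, inclMatrix, submatrix_apply, id, Matrix.one_apply, Fin.ext_iff,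
    Fin.val_castLE, Fin.val_rev]
  congr 1
  simp only [eq_iff_iff]
  omega

theorem QuasiInverse.adapted_revMatrix {N m r : ℕ} (hr : r ≤ N) {c : Matrix (Fin N) (Fin r) F}
    {w : Matrix (Fin r) (Fin N) F} (h : QuasiInverse m r c w) :
    Adapted m r c w (revMatrix F hr) (revMatrix F hr)ᵀ := by
  refine ⟨h, ?_, ?_⟩
  · rw [revMatrix, transpose_submatrix]
    refine (submatrix_mul_equiv _ _ Fin.rev (Equiv.refl _) Fin.rev).trans ?_
    rw [inclMatrix_transpose_mul_self, submatrix_one _ Fin.rev_injective]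
  · rw [revMatrix, transpose_submatrix]
    refine (submatrix_mul_equiv _ _ id Fin.revPerm id).trans ?_
    rw [inclMatrix_mul_transpose, submatrix_id_id]

end Inclusion

/-! ### Induced operators with image in the old coordinates -/

section Extension

variable {F : Type*} [Field F] {ι κ : Type*} [Fintype ι] [DecidableEq ι] [Fintype κ]
  [DecidableEq κ] {N m r : ℕ}

theorem single_mul_levelProj (b a : Fin N) :
    single b a (1 : F) * levelProj N F r = if (a : ℕ) < r then single b a (1 : F) else 0 := by
  ext i j
  rw [mul_levelProj_apply]
  by_cases hj : a = j
  · subst hj; split_ifs <;> simp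
  · rw [single_apply_of_col_ne _ _ hj]
    split_ifs <;> simp [hj]

theorem levelProj_mul_single {κ' : Type*} [DecidableEq κ'] (b : Fin N) (a : κ') :
    levelProj N F r * single b a (1 : F) = if (b : ℕ) < r then single b a (1 : F) else 0 := by
  ext i j
  rw [levelProj_mul_apply]
  by_cases hj : b = i
  · subst hj; split_ifs <;> simp
  · rw [single_apply_of_row_ne hj]
    split_ifs <;> simp [hj]

variable {c : Matrix (Fin N) κ F} {w : Matrix κ (Fin N) F}

theorem QuasiInverse.mul_eq_zero (h : QuasiInverse m r c w) (hc : levelProj N F m * c = c) :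
    (levelProj N F m - c * w) * c = 0 := by
  rw [Matrix.sub_mul, hc, h.regular, sub_self]

theorem QuasiInverse.mul_single (h : QuasiInverse m r c w) {b : Fin N} (hr : r ≤ b)
    (hm : (b : ℕ) < m) {κ' : Type*} [DecidableEq κ'] (a : κ') :
    (levelProj N F m - c * w) * single b a (1 : F) = single b a (1 : F) := by
  rw [Matrix.sub_mul, levelProj_mul_single, if_pos hm, ← h.mul_levelProj, ← Matrix.mul_assoc,
    Matrix.mul_assoc _ (levelProj N F r), levelProj_mul_single, if_neg (by omega), Matrix.mul_zero,
    sub_zero]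

theorem QuasiInverse.single_mul (h : QuasiInverse m r c w) {a : Fin N} (hr : (a : ℕ) < r)
    (b : Fin N) : single b a (1 : F) * (levelProj N F m - c * w) = 0 := by
  have : single b a (1 : F) = single b a (1 : F) * levelProj N F r := by
    rw [single_mul_levelProj, if_pos hr]
  rw [this, Matrix.mul_assoc, h.levelProj_mul, Matrix.mul_zero]

variable {U : Submodule F (Matrix ι ι F)}
    {U' : Submodule F (Matrix (ι ⊕ κ) (ι ⊕ κ) F)} {x : Matrix ι ι F} {z : Matrix ι κ F}
    {π : Matrix (Fin N) ι F} {τ : Matrix ι (Fin N) F}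
    {Z : Matrix (Fin N) κ F} {Z' : Matrix κ (Fin N) F}

/-- Coordinates below `r` belong to the new block, so such an operator maps the new block to the old
ones. It comes from the freely prescribed upper right entries, with no diagonal part. -/
theorem realizes_extension_of_lt_of_le (hx : ∀ θ ∈ U, ∀ Y, fromBlocks (θ * x) Y 0 0 ∈ U')
    (hlift : ∀ Y : Matrix ι κ F, ∃ θ ∈ U, θ * x = x * θ ∧
      ∃ (V : Matrix ι κ F) (W : Matrix κ κ F), θ * z = Y + x * V + z * W)
    (h : IsCokernel x m π τ) (hA : Adapted m r (π * z) w Z Z') {b a : Fin N}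
    (har : (a : ℕ) < r) (hrb : r ≤ b) (hbm : (b : ℕ) < m) :
    Realizes U' (fromBlocks x z 0 0) (fromCols ((levelProj N F m - π * z * w) * π) Z)
      (single b a (1 : F)) := by
  have hc : levelProj N F m * (π * z) = π * z := by rw [← Matrix.mul_assoc, h.levelProj_mul]
  obtain ⟨Θ, h1, h2, h3⟩ := exists_commute_extension (Z := Z) (θ := 0) (w₀ := 0) hx hlift h
    (hA.mul_eq_zero hc) (by simp) (by simp) (fun Y => by simpa using hx 0 U.zero_mem Y)
    (τ * (single b a (1 : F) * Z))
  refine ⟨Θ, h1, h2, ?_⟩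
  rw [h3, mul_fromCols, ← Matrix.mul_assoc π, h.proj, ← Matrix.mul_assoc (levelProj N F m),
    levelProj_mul_single, if_pos hbm, ← Matrix.mul_assoc, hA.mul_single hrb hbm,
    ← Matrix.mul_assoc (single b a (1 : F)) _ π, hA.single_mul har]
  simp

/-- Both coordinates belong to the old blocks. An old commuting matrix extends with zero action on
the new block once it kills the image of `z` in the cokernel, and the factor `levelProj N F m - π *
z * w` ensures this. -/
theorem realizes_extension_of_le_of_le {U₀ : Submodule F (Matrix ι ι F)}
    (hx : ∀ θ ∈ U, ∀ Y, fromBlocks (θ * x) Y 0 0 ∈ U')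
    (hlift : ∀ Y : Matrix ι κ F, ∃ θ ∈ U, θ * x = x * θ ∧
      ∃ (V : Matrix ι κ F) (W : Matrix κ κ F), θ * z = Y + x * V + z * W)
    (h : IsCokernel x m π τ) (hA : Adapted m r (π * z) w Z Z') {b a : Fin N}
    (hra : r ≤ a) (hrb : r ≤ b) (hbm : (b : ℕ) < m)
    (hU₀ : ∀ θ ∈ U₀, ∀ Y, fromBlocks θ Y 0 0 ∈ U')
    (hT : Realizes U₀ x π (single b a (1 : F) * (levelProj N F m - π * z * w))) :
    Realizes U' (fromBlocks x z 0 0) (fromCols ((levelProj N F m - π * z * w) * π) Z)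
      (single b a (1 : F)) := by
  have hc : levelProj N F m * (π * z) = π * z := by rw [← Matrix.mul_assoc, h.levelProj_mul]
  obtain ⟨θ, h4, h5, h6⟩ := hT
  obtain ⟨Θ, h1, h2, h3⟩ := exists_commute_extension (Z := Z) (θ := θ) (w₀ := 0) hx hlift h
    (hA.mul_eq_zero hc) h5 (by
      rw [Matrix.mul_zero, sub_zero, ← Matrix.mul_assoc, h6, Matrix.mul_assoc, Matrix.mul_assoc,
        hA.mul_eq_zero hc, Matrix.mul_zero]) (hU₀ θ h4) 0
  refine ⟨Θ, h1, h2, ?_⟩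
  have h7 : single b a (1 : F) * Z = 0 := by
    rw [← hA.levelProj_mul_right, ← Matrix.mul_assoc, single_mul_levelProj, if_neg (by omega),
      Matrix.zero_mul]
  rw [h3, mul_fromCols, Matrix.mul_assoc _ π, h6, h7, ← Matrix.mul_assoc, ← Matrix.mul_assoc,
    hA.mul_single hrb hbm, Matrix.mul_assoc]
  simp

end Extension

/-! ### Extending the two descriptions of the centraliser by a block -/

section Blocks

/-- The position of the basis vectors: the block, the place in the block counted from the first and
from the last element, and the place among all basis vectors. -/
structure Blocks (ι : Type*) where
  blk : ι → ℕ
  pos : ι → ℕ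
  rev : ι → ℕ
  ord : ι → ℕ

variable {F : Type*} [Field F] {ι : Type*} [Fintype ι] [DecidableEq ι] {N m : ℕ}

/-- Append a block with number `k` and `r` elements, where `R` elements precede it. -/
def Blocks.extend (D : Blocks ι) (k R r : ℕ) : Blocks (ι ⊕ Fin r) where
  blk := Sum.elim D.blk fun _ => k
  pos := Sum.elim D.pos fun p => p
  rev := Sum.elim D.rev fun p => r - 1 - p
  ord := Sum.elim D.ord fun p => R + p

/-- The row `i` contains no element of the base among the columns of the first `k` blocks. -/
def Blocks.Final (D : Blocks ι) (r : ℕ → ℕ) (k : ℕ) (i : ι) : Prop :=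
  ∀ s, D.blk i < s → s < k → r s ≤ D.rev i

/-- The entry in row `i` and in the column `a` of the next block can be removed by the centraliser. -/
def Blocks.Kill (D : Blocks ι) (r : ℕ → ℕ) (k : ℕ) (i : ι) (a : ℕ) : Prop :=
  a < D.rev i ∧ ((∀ s < D.blk i, r s ≤ D.pos i) ∨ ∃ s, D.blk i < s ∧ s < k ∧ a < r s)

/-- Matrices supported on the positions in `R`. -/
def supportedOn (F : Type*) [Field F] {ι : Type*} (R : ι → ι → Prop) :
    Submodule F (Matrix ι ι F) where
  carrier := {x | ∀ i j, ¬ R i j → x i j = 0}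
  add_mem' := by
    intro x y hx hy i j h
    simp [hx i j h, hy i j h]
  zero_mem' := by
    intro i j _
    rfl
  smul_mem' := by
    intro a x hx i j h
    simp [hx i j h]

theorem mul_mem_supportedOn {R S T : ι → ι → Prop} (h : ∀ i j l, R i j → S j l → T i l)
    {x y : Matrix ι ι F} (hx : x ∈ supportedOn F R) (hy : y ∈ supportedOn F S) :
    x * y ∈ supportedOn F T := by
  intro i l hil
  rw [Matrix.mul_apply]
  refine Finset.sum_eq_zero fun j _ => ?_
  by_cases h1 : R i j
  · rw [hy j l fun h2 => hil (h i j l h1 h2), mul_zero]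
  · rw [hx i j h1, zero_mul]

/-- Matrices preserving the flag of blocks. -/
def Blocks.parabolic (F : Type*) [Field F] (D : Blocks ι) : Submodule F (Matrix ι ι F) :=
  supportedOn F fun i j => D.blk i ≤ D.blk j

/-- Matrices of the nilradical. -/
def Blocks.nil (F : Type*) [Field F] (D : Blocks ι) : Submodule F (Matrix ι ι F) :=
  supportedOn F fun i j => D.blk i < D.blk j

/-- Strictly upper triangular matrices. -/
def Blocks.strict (F : Type*) [Field F] (D : Blocks ι) : Submodule F (Matrix ι ι F) :=
  supportedOn F fun i j => D.ord i < D.ord j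

theorem Blocks.fromBlocks_mem_parabolic {D : Blocks ι} {k R r : ℕ} (hk : ∀ i, D.blk i < k)
    {θ : Matrix ι ι F} (hθ : θ ∈ D.parabolic F) (Y : Matrix ι (Fin r) F)
    (w : Matrix (Fin r) (Fin r) F) : fromBlocks θ Y 0 w ∈ (D.extend k R r).parabolic F := by
  rintro (i | i) (j | j) h
  · exact hθ i j h
  · exact absurd (hk i).le h
  · rfl
  · exact absurd le_rfl h

theorem Blocks.fromBlocks_mem_strict {D : Blocks ι} {k R r : ℕ} (hR : ∀ i, D.ord i < R)
    {θ : Matrix ι ι F} (hθ : θ ∈ D.strict F) (Y : Matrix ι (Fin r) F)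
    {w : Matrix (Fin r) (Fin r) F} (hw : ∀ p q, ¬ p < q → w p q = 0) :
    fromBlocks θ Y 0 w ∈ (D.extend k R r).strict F := by
  rintro (i | i) (j | j) h
  · exact hθ i j h
  · exact absurd ((hR i).trans_le (Nat.le_add_right _ _)) h
  · rfl
  · refine hw i j fun h' => h ?_
    exact Nat.add_lt_add_left h' R

/-- The standard basis vectors of the rows without elements of the base. -/
noncomputable def Blocks.rowMatrix (F : Type*) [Field F] (D : Blocks ι) (r : ℕ → ℕ) (k N : ℕ) :
    Matrix ι (Fin N) F :=
  open Classical in of fun i b => if D.Final r k i ∧ D.rev i = b then 1 else 0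

/-- The centraliser of `y` in the parabolic algebra acts on the cokernel of `y` through an algebra
containing all lower triangular matrices in suitable coordinates `σ`. -/
structure Blocks.BlockState (D : Blocks ι) (m : ℕ) (y : Matrix ι ι F) (σ : Matrix (Fin N) ι F)
    (τ : Matrix ι (Fin N) F) : Prop where
  coker : IsCokernel y m σ τ
  realizes : ∀ b a : Fin N, a ≤ b → (b : ℕ) < m → Realizes (D.parabolic F) y σ (single b a (1 : F))

/-- The strictly upper triangular matrices commuting with `y` allow to remove the entries in the
positions `D.Kill r k`. -/
structure Blocks.RowState (D : Blocks ι) (r : ℕ → ℕ) (k m : ℕ) (y : Matrix ι ι F)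
    (π : Matrix (Fin N) ι F) : Prop where
  coker : IsCokernel y m π (D.rowMatrix F r k N)
  realizes : ∀ i (b a : Fin N), D.Final r k i → D.rev i = b → D.Kill r k i a →
    Realizes (D.strict F) y π (single b a (1 : F))

/-- An elementary matrix is treated according to whether its row and column indices lie below `r`.
The condition that `Z` agrees with `σ * z` on common rows lets a lower triangular operator on the
new block be matched by a lower triangular one on the old cokernel. -/
theorem Blocks.BlockState.extend {D : Blocks ι} {k R r : ℕ} {y : Matrix ι ι F}
    {σ : Matrix (Fin N) ι F} {τ : Matrix ι (Fin N) F} (h : D.BlockState m y σ τ)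
    (hk : ∀ i, D.blk i < k) (hy : y ∈ D.nil F) {z : Matrix ι (Fin r) F}
    {w : Matrix (Fin r) (Fin N) F} {Z : Matrix (Fin N) (Fin r) F} {Z' : Matrix (Fin r) (Fin N) F}
    (hA : Adapted m r (σ * z) w Z Z') (hZ' : σ * z * Z' = σ * z * w)
    (hZ : ∀ a : Fin N, (a : ℕ) < m → (a : ℕ) < r → ∀ p, Z a p = (σ * z) a p) :
    (D.extend k R r).BlockState (max m r) (fromBlocks y z 0 0)
      (fromCols ((levelProj N F m - σ * z * w) * σ) Z)
      (fromRows (τ * (1 - levelProj N F r)) Z') := by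
  refine ⟨h.coker.fromBlocks hA, ?_⟩
  have hc : levelProj N F m * (σ * z) = σ * z := by
    rw [← Matrix.mul_assoc, h.coker.levelProj_mul]
  have hlift := exists_commute_lift h.coker hA h.realizes
  have hx : ∀ θ ∈ D.parabolic F, ∀ Y, fromBlocks (θ * y) Y 0 0 ∈ (D.extend k R r).parabolic F :=
    fun θ hθ Y => fromBlocks_mem_parabolic hk
      (mul_mem_supportedOn (fun i j l h1 h2 => h1.trans (le_of_lt h2)) hθ hy) Y 0
  intro b a hab hb
  rcases lt_or_ge (b : ℕ) r with hbr | hrb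
  · have har : (a : ℕ) < r := lt_of_le_of_lt hab hbr
    -- An operator on the new block forces this one on the old cokernel. It is lower triangular: the
    -- first `r` rows of `σ * z * w` agree with those of `levelProj N F m`, and in the later rows
    -- the column index `a < r` is smaller anyway.
    have hT : Realizes (D.parabolic F) y σ (σ * z * w * single b a (1 : F)) := by
      refine realizes_of_single fun b' a' hne => ?_
      have ha : a' = a := by
        by_contra h'
        exact hne (mul_single_apply_of_ne _ _ _ _ _ h' _)
      subst ha
      rw [mul_single_apply_same, mul_one] at hne
      have hb'm : (b' : ℕ) < m := by
        by_contra h'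
        rw [← hc, Matrix.mul_assoc, levelProj_mul_apply, if_neg h'] at hne
        exact hne rfl
      refine h.realizes _ _ ?_ hb'm
      by_contra hlt
      have h1 := hA.levelProj_mul
      rw [Matrix.mul_sub, sub_eq_zero] at h1
      have h2 := congrFun (congrFun h1 b') b
      have hb'r : (b' : ℕ) < r := by omega
      rw [levelProj_mul_apply, levelProj_mul_apply, if_pos hb'r, if_pos hb'r] at h2
      rw [← h2, levelProj, diagonal_apply_ne _ (by intro h3; subst h3; exact hlt hab)] at hne
      exact hne rfl
    obtain ⟨θ, h4, h5, h6⟩ := hT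
    obtain ⟨Θ, h1, h2, h3⟩ := exists_commute_extension (Z := Z) (θ := θ)
      (w₀ := Z' * single b a (1 : F) * Z) hx hlift h.coker (hA.mul_eq_zero hc) h5 (by
        rw [Matrix.mul_sub, ← Matrix.mul_assoc, h6, ← Matrix.mul_assoc σ, ← Matrix.mul_assoc,
          ← Matrix.mul_assoc, hZ', Matrix.mul_assoc _ σ z, Matrix.mul_assoc _ _ (σ * z),
          Matrix.mul_assoc _ _ Z, ← Matrix.mul_sub]
        by_cases hbm : (b : ℕ) < m
        · have : single b a (1 : F) * (σ * z) - single b a (1 : F) * Z = 0 := by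
            rw [← Matrix.mul_sub]
            ext i p
            by_cases hi : i = b
            · subst hi
              rw [single_mul_apply_same, Matrix.sub_apply, hZ a (lt_of_le_of_lt hab hbm) har p]
              simp
            · rw [single_mul_apply_of_ne _ _ _ _ _ hi]
              rfl
          rw [this, Matrix.mul_zero]
        · rw [← Matrix.mul_sub, Matrix.mul_assoc, ← Matrix.mul_assoc w, ← hA.mul_levelProj',
            Matrix.mul_assoc w, levelProj_mul_single, if_neg hbm]
          simp)
      (fun Y => fromBlocks_mem_parabolic hk h4 Y _) 0
    refine ⟨Θ, h1, h2, ?_⟩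
    rw [h3, mul_fromCols, ← Matrix.mul_assoc (single b a (1 : F)), hA.single_mul har,
      Matrix.mul_assoc _ σ, h6, ← Matrix.mul_assoc, ← Matrix.mul_assoc, ← Matrix.mul_assoc,
      hA.mul_eq_zero hc, ← Matrix.mul_assoc, ← Matrix.mul_assoc, hA.right_inv,
      levelProj_mul_single, if_pos hbr]
    simp
  · have hbm : (b : ℕ) < m := by
      rcases lt_max_iff.1 hb with h1 | h1 <;> omega
    rcases lt_or_ge (a : ℕ) r with har | hra
    · exact realizes_extension_of_lt_of_le hx hlift h.coker hA har hrb hbm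
    · refine realizes_extension_of_le_of_le hx hlift h.coker hA hra hrb hbm
        (fun θ hθ Y => fromBlocks_mem_parabolic hk hθ Y 0) ?_
      refine realizes_of_single fun b' a' hne => ?_
      have hb' : b' = b := by
        by_contra h'
        exact hne (single_mul_apply_of_ne _ _ _ _ _ h' _)
      subst hb'
      refine h.realizes _ _ ?_ hbm
      rw [single_mul_apply_same, one_mul, Matrix.sub_apply] at hne
      by_contra hlt
      apply hne
      rw [levelProj, diagonal_apply_ne _ (by intro h3; subst h3; exact hlt hab),
        ← hA.mul_levelProj, ← Matrix.mul_assoc, mul_levelProj_apply, if_neg (by omega), sub_zero]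

/-- The coordinate of a surviving row is its distance from the end of its block, hence the reversal
on the new block. For old rows, columns below `r k` become removable through the free upper right
entries, and the others stay so. A new row has only operators inside its own block at its disposal.
-/
theorem Blocks.RowState.extend {D : Blocks ι} {r : ℕ → ℕ} {k R : ℕ} {y : Matrix ι ι F}
    {π : Matrix (Fin N) ι F} (h : D.RowState r k m y π)
    (hk : ∀ i, D.blk i < k) (hR : ∀ i, D.ord i < R)
    (hord : ∀ i j, D.blk i < D.blk j → D.ord i < D.ord j) (hy : y ∈ D.nil F)
    (hm : ∀ M, (∀ s < k, r s ≤ M) → m ≤ M) (hm' : ∀ i, D.rev i < m) {z : Matrix ι (Fin (r k)) F}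
    (hlift : ∀ Y : Matrix ι (Fin (r k)) F, ∃ θ ∈ D.parabolic F, θ * y = y * θ ∧
      ∃ (V : Matrix ι (Fin (r k)) F) (W : Matrix (Fin (r k)) (Fin (r k)) F),
        θ * z = Y + y * V + z * W)
    {w : Matrix (Fin (r k)) (Fin N) F} (hw : QuasiInverse m (r k) (π * z) w)
    (hc0 : ∀ (b : Fin N) (p : Fin (r k)), (b : ℕ) < p → (π * z) b p = 0) (hr : r k ≤ N) :
    (D.extend k R (r k)).RowState r (k + 1) (max m (r k)) (fromBlocks y z 0 0)
      (fromCols ((levelProj N F m - π * z * w) * π) (revMatrix F hr)) := by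
  have hA := hw.adapted_revMatrix hr
  have hc : levelProj N F m * (π * z) = π * z := by
    rw [← Matrix.mul_assoc, h.coker.levelProj_mul]
  have hx : ∀ θ ∈ D.parabolic F, ∀ Y,
      fromBlocks (θ * y) Y 0 0 ∈ (D.extend k R (r k)).strict F :=
    fun θ hθ Y => fromBlocks_mem_strict hR
      (mul_mem_supportedOn (fun i j l (h1 : D.blk i ≤ D.blk j) (h2 : D.blk j < D.blk l) =>
        hord _ _ (lt_of_le_of_lt h1 h2)) hθ hy) Y
      (by simp)
  refine ⟨?_, ?_⟩
  · have hrow : (D.extend k R (r k)).rowMatrix F r (k + 1) N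
        = fromRows (D.rowMatrix F r k N * (1 - levelProj N F (r k))) (revMatrix F hr)ᵀ := by
      classical
      ext (i | p) b
      · rw [fromRows_apply_inl, Matrix.mul_sub, Matrix.sub_apply, mul_levelProj_apply,
          Matrix.mul_one]
        simp only [rowMatrix, of_apply]
        have : (D.extend k R (r k)).Final r (k + 1) (Sum.inl i) ↔
            D.Final r k i ∧ r k ≤ D.rev i := by
          constructor
          · exact fun h1 => ⟨fun s h2 h3 => h1 s h2 (h3.trans k.lt_succ_self),
              h1 k (hk i) k.lt_succ_self⟩
          · rintro ⟨h1, h2⟩ s h3 h4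
            rcases Nat.lt_succ_iff_lt_or_eq.1 h4 with h5 | rfl
            · exact h1 s h3 h5
            · exact h2
        have hrev : (D.extend k R (r k)).rev (Sum.inl i) = D.rev i := rfl
        simp only [this, hrev]
        by_cases h1 : D.Final r k i <;> by_cases h2 : D.rev i = b <;>
          by_cases h3 : (b : ℕ) < r k <;> simp [h1, h2, h3]
      · rw [fromRows_apply_inr, transpose_apply, revMatrix_apply]
        simp only [rowMatrix, of_apply]
        have : (D.extend k R (r k)).Final r (k + 1) (Sum.inr p) := by
          intro s h1 h2
          change k < s at h1
          omega
        simp only [this, true_and]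
        change (if r k - 1 - (p : ℕ) = b then (1 : F) else 0) = _
        congr 1
        simp only [eq_iff_iff]
        have := p.2
        omega
    rw [hrow]
    exact h.coker.fromBlocks hA
  · rintro (i | p) b a hF hb hK
    · change D.rev i = b at hb
      have hbm : (b : ℕ) < m := hb ▸ hm' i
      have hrb : r k ≤ b := hb ▸ hF k (hk i) k.lt_succ_self
      rcases lt_or_ge (a : ℕ) (r k) with har | hra
      · exact realizes_extension_of_lt_of_le hx hlift h.coker hA har hrb hbm
      · refine realizes_extension_of_le_of_le hx hlift h.coker hA hra hrb hbm
          (fun θ hθ Y => fromBlocks_mem_strict hR hθ Y (by simp)) ?_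
        -- The new block cannot be the reason for removability here, because `a` is at least `r k`.
        have hKa : ∀ a' ≤ (a : ℕ), D.Kill r k i a' := by
          intro a' ha'
          refine ⟨lt_of_le_of_lt ha' hK.1, ?_⟩
          rcases hK.2 with h1 | ⟨s, h1, h2, h3⟩
          · exact Or.inl h1
          · refine Or.inr ⟨s, h1, ?_, lt_of_le_of_lt ha' h3⟩
            rcases Nat.lt_succ_iff_lt_or_eq.1 h2 with h5 | rfl
            · exact h5
            · omega
        refine realizes_of_single fun b' a' hne => ?_
        have hb' : b' = b := by
          by_contra h'
          exact hne (single_mul_apply_of_ne _ _ _ _ _ h' _)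
        subst hb'
        refine h.realizes i _ _ (fun s h1 h2 => hF s h1 (h2.trans k.lt_succ_self)) hb (hKa _ ?_)
        rw [single_mul_apply_same, one_mul, Matrix.sub_apply] at hne
        by_contra hlt
        apply hne
        rw [levelProj, diagonal_apply_ne _ (by intro h3; subst h3; exact hlt le_rfl),
          ← hA.mul_levelProj, ← Matrix.mul_assoc, mul_levelProj_apply, if_neg (by omega), sub_zero]
    · change r k - 1 - (p : ℕ) = b at hb
      obtain ⟨hK1, hK2⟩ := hK
      change (a : ℕ) < r k - 1 - (p : ℕ) at hK1
      -- No block follows the new one, so removability means that no earlier block has more than `p`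
      -- elements. Then column `p` of `π * z` vanishes, and an operator inside the new block that
      -- reaches only this column commutes without an old part.
      have hmp : m ≤ p := by
        refine hm _ ?_
        rcases hK2 with h1 | ⟨s, h1, h2, -⟩
        · exact h1
        · change k < s at h1
          omega
      have har : (a : ℕ) < r k := by omega
      obtain ⟨Θ, h1, h2, h3⟩ := exists_commute_extension (Z := revMatrix F hr) (θ := 0)
        (w₀ := single p ⟨r k - 1 - a, by omega⟩ (1 : F)) hx hlift h.coker
        (hA.mul_eq_zero hc) (by simp) (by
          rw [Matrix.zero_mul, zero_sub, Matrix.mul_neg, neg_eq_zero, ← Matrix.mul_assoc]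
          ext b' q
          by_cases hq : q = ⟨r k - 1 - a, by omega⟩
          · subst hq
            rw [mul_single_apply_same, mul_one]
            rcases lt_or_ge (b' : ℕ) m with h4 | h4
            · exact hc0 _ _ (by omega)
            · rw [← hc, levelProj_mul_apply, if_neg (by omega)]
              rfl
          · rw [mul_single_apply_of_ne _ _ _ _ _ hq]
            rfl)
        (fun Y => fromBlocks_mem_strict hR (Submodule.zero_mem _) Y (by
          intro p' q' hpq
          rw [single_apply, if_neg]
          rintro ⟨rfl, rfl⟩
          apply hpq
          rw [Fin.lt_def]
          change (p : ℕ) < r k - 1 - a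
          omega)) 0
      refine ⟨Θ, h1, h2, ?_⟩
      rw [h3, mul_fromCols, ← Matrix.mul_assoc (single b a (1 : F)), hA.single_mul har]
      have h5 : revMatrix F hr * single p ⟨r k - 1 - a, by omega⟩ (1 : F)
          = single b a (1 : F) * revMatrix F hr := by
        ext b' q
        by_cases hb' : b' = b
        · subst hb'
          rw [single_mul_apply_same, revMatrix_apply, one_mul]
          by_cases hq : q = ⟨r k - 1 - a, by omega⟩
          · subst hq
            rw [mul_single_apply_same, revMatrix_apply, if_pos (by omega), mul_one, if_pos]
            simp only
            omega
          · rw [mul_single_apply_of_ne _ _ _ _ _ hq, if_neg]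
            intro h6
            apply hq
            ext
            simp only
            omega
        · rw [single_mul_apply_of_ne _ _ _ _ _ hb']
          by_cases hq : q = ⟨r k - 1 - a, by omega⟩
          · subst hq
            rw [mul_single_apply_same, revMatrix_apply, if_neg, zero_mul]
            intro h6
            apply hb'
            ext
            omega
          · rw [mul_single_apply_of_ne _ _ _ _ _ hq]
      rw [h5]
      simp

end Blocks

/-! ### Triangular factorisation and clearing of entries -/

section Elimination

variable {F : Type*} [Field F] {N m r : ℕ}

/-- Cramer's rule: earlier columns clear column `p` above row `p`, by the leading minors. A zero
further down would put the coefficient vector in the kernel of the minor formed by the first `p`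
rows and that row. Rows from `m` on are zero, so only `min p m` conditions occur. -/
theorem exists_column_elimination {c : Matrix (Fin N) (Fin r) F} (hm : m ≤ N)
    (hc : levelProj N F m * c = c)
    (hlead : ∀ q (h1 : q ≤ m) (h2 : q ≤ r),
      (c.submatrix (Fin.castLE (h1.trans hm)) (Fin.castLE h2)).det ≠ 0)
    (hminor : ∀ p (hp : p < r) (hpN : p ≤ N) (b : Fin N), p ≤ b → (b : ℕ) < m →
      (c.submatrix (Fin.snoc (α := fun _ => Fin N) (Fin.castLE hpN) b) (Fin.castLE hp)).det ≠ 0)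
    (p : Fin r) :
    ∃ u : Fin r → F, u p = 1 ∧ (∀ q, p < q → u q = 0) ∧
      (∀ b : Fin N, (b : ℕ) < p → (c *ᵥ u) b = 0) ∧
      ∀ b : Fin N, (p : ℕ) ≤ b → (b : ℕ) < m → (c *ᵥ u) b ≠ 0 := by
  obtain ⟨p, hp⟩ := p
  have hrow : ∀ (u : Fin r → F) (b : Fin N), m ≤ b → (c *ᵥ u) b = 0 := by
    intro u b hb
    rw [← hc, ← mulVec_mulVec, mulVec]
    simp [dotProduct, levelProj, diagonal_apply, hb.not_gt]
  have hq1 : min p m ≤ m := min_le_right _ _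
  have hq2 : min p m ≤ r := (min_le_left _ _).trans hp.le
  have hA := hlead _ hq1 hq2
  set A := c.submatrix (Fin.castLE (hq1.trans hm)) (Fin.castLE hq2) with hAdef
  set v : Fin (min p m) → F := A⁻¹ *ᵥ fun b => - c (Fin.castLE (hq1.trans hm) b) ⟨p, hp⟩ with hv
  have hAv : A *ᵥ v = fun b => - c (Fin.castLE (hq1.trans hm) b) ⟨p, hp⟩ := by
    rw [hv, mulVec_mulVec, mul_nonsing_inv A (isUnit_iff_ne_zero.2 hA), one_mulVec]
  set u : Fin r → F := inclMatrix F hq2 *ᵥ v + Pi.single ⟨p, hp⟩ 1 with hu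
  have hincl : ∀ a : Fin r, min p m ≤ a → (inclMatrix F hq2 *ᵥ v) a = 0 := by
    intro a ha
    rw [mulVec]
    refine Finset.sum_eq_zero fun j _ => ?_
    simp only [inclMatrix, submatrix_apply, id, Matrix.one_apply]
    rw [if_neg, zero_mul]
    intro h
    have := congrArg Fin.val h
    simp only [Fin.val_castLE] at this
    have := j.2
    omega
  have hup : u ⟨p, hp⟩ = 1 := by
    rw [hu, Pi.add_apply, hincl _ (min_le_left _ _)]
    simp
  have huq : ∀ q, (⟨p, hp⟩ : Fin r) < q → u q = 0 := by
    intro q hq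
    rw [hu, Pi.add_apply, hincl q ((min_le_left _ _).trans (le_of_lt hq)),
      Pi.single_eq_of_ne (ne_of_gt hq), add_zero]
  have hcu : ∀ b : Fin N, (b : ℕ) < min p m → (c *ᵥ u) b = 0 := by
    intro b hb
    have h1 := congrFun hAv ⟨b, hb⟩
    rw [hu, mulVec_add, mulVec_mulVec, mul_inclMatrix, Pi.add_apply, mulVec_single_one]
    have h2 : (c.submatrix id (Fin.castLE hq2) *ᵥ v) b = (A *ᵥ v) ⟨b, hb⟩ := rfl
    rw [h2, h1]
    exact neg_add_cancel _
  have hcu' : ∀ b : Fin N, (b : ℕ) < p → (c *ᵥ u) b = 0 := by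
    intro b hb
    rcases lt_or_ge (b : ℕ) m with h | h
    · exact hcu b (lt_min hb h)
    · exact hrow u b h
  refine ⟨u, hup, huq, hcu', ?_⟩
  intro b hpb hbm h0
  have hpN : p ≤ N := by
    have : (p : ℕ) ≤ b := hpb
    omega
  have hdet := hminor p hp hpN b hpb hbm
  have hext : u = inclMatrix F hp *ᵥ (u ∘ Fin.castLE hp) := by
    ext a
    rw [mulVec, dotProduct]
    simp only [inclMatrix, submatrix_apply, id, Matrix.one_apply]
    by_cases ha : (a : ℕ) < p + 1
    · rw [Finset.sum_eq_single ⟨a, ha⟩]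
      · have h1 : Fin.castLE hp ⟨a, ha⟩ = a := rfl
        rw [Function.comp_apply, h1, if_pos rfl, one_mul]
      · intro j _ hj
        rw [if_neg (fun h : a = Fin.castLE hp j => hj (Fin.ext (congrArg Fin.val h).symm)), zero_mul]
      · simp
    · rw [Finset.sum_eq_zero]
      · exact huq a (by rw [Fin.lt_def]; change p < (a : ℕ); omega)
      · intro j _
        rw [if_neg, zero_mul]
        intro h
        have := congrArg Fin.val h
        simp only [Fin.val_castLE] at this
        have := j.2
        omega
  have hzero := eq_zero_of_mulVec_eq_zero hdet (v := u ∘ Fin.castLE hp) (by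
    have h1 : ∀ b' : Fin N, (c.submatrix id (Fin.castLE hp) *ᵥ (u ∘ Fin.castLE hp)) b'
        = (c *ᵥ u) b' := by
      intro b'
      rw [← mul_inclMatrix, ← mulVec_mulVec, ← hext]
    ext i
    change (c.submatrix id (Fin.castLE hp) *ᵥ (u ∘ Fin.castLE hp))
      (Fin.snoc (α := fun _ => Fin N) (Fin.castLE hpN) b i) = 0
    rw [h1]
    refine Fin.lastCases ?_ (fun j => ?_) i
    · rw [Fin.snoc_last]
      exact h0
    · rw [Fin.snoc_castSucc]
      exact hcu' _ j.2)
  have := congrFun hzero (Fin.last p)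
  simp only [Function.comp_apply, Pi.zero_apply] at this
  have h2 : Fin.castLE hp (Fin.last p) = ⟨p, hp⟩ := rfl
  rw [h2, hup] at this
  exact one_ne_zero this

theorem exists_lower_upper {c : Matrix (Fin N) (Fin r) F} (hm : m ≤ N)
    (hc : levelProj N F m * c = c)
    (hlead : ∀ q (h1 : q ≤ m) (h2 : q ≤ r),
      (c.submatrix (Fin.castLE (h1.trans hm)) (Fin.castLE h2)).det ≠ 0)
    (hminor : ∀ p (hp : p < r) (hpN : p ≤ N) (b : Fin N), p ≤ b → (b : ℕ) < m →
      (c.submatrix (Fin.snoc (α := fun _ => Fin N) (Fin.castLE hpN) b) (Fin.castLE hp)).det ≠ 0) :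
    ∃ (L : Matrix (Fin N) (Fin r) F) (V : Matrix (Fin r) (Fin r) F), c = L * V ∧
      BlockTriangular V id ∧ IsUnit V.det ∧ (∀ (b : Fin N) (p : Fin r), (b : ℕ) < p → L b p = 0) ∧
      ∀ (b : Fin N) (p : Fin r), (p : ℕ) ≤ b → (b : ℕ) < m → L b p ≠ 0 := by
  choose u h1 h2 h3 h4 using exists_column_elimination hm hc hlead hminor
  set U : Matrix (Fin r) (Fin r) F := of fun a p => u p a with hU
  have hUt : BlockTriangular U id := fun a p hap => h2 p a hap
  have hUdet : U.det = 1 := by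
    rw [det_of_isUpperTriangular hUt]
    exact Finset.prod_eq_one fun p _ => h1 p
  have hUu : IsUnit U.det := by rw [hUdet]; exact isUnit_one
  have hcU : ∀ b p, (c * U) b p = (c *ᵥ u p) b := fun b p => rfl
  refine ⟨c * U, U⁻¹, ?_, ?_, ?_, fun b p hb => ?_, fun b p hp hb => ?_⟩
  · rw [Matrix.mul_assoc, mul_nonsing_inv U hUu, Matrix.mul_one]
  · have := invertibleOfIsUnitDet U hUu
    exact blockTriangular_inv_of_blockTriangular hUt
  · exact isUnit_nonsing_inv_det U hUu
  · rw [hcU]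
    exact h3 p b hb
  · rw [hcU]
    exact h4 p b hp hb

/-- Solve for the last coefficient first. Rows before `d` of the lower triangular `L` do not reach
the columns from `d` on, so nothing is disturbed there. -/
theorem exists_row_combination {L : Matrix (Fin N) (Fin r) F}
    (hL0 : ∀ (b : Fin N) (p : Fin r), (b : ℕ) < p → L b p = 0) (hm : m ≤ N)
    (hL1 : ∀ (b : Fin N) (p : Fin r), (p : ℕ) = b → (b : ℕ) < m → L b p ≠ 0)
    (d : ℕ) (hdm : d ≤ m) (hdr : d ≤ r) (t : Fin r → F) :
    ∃ x : Fin N → F, (∀ a : Fin N, d ≤ a → x a = 0) ∧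
      ∀ p : Fin r, (x ᵥ* L) p = if (p : ℕ) < d then t p else 0 := by
  induction d generalizing t with
  | zero => exact ⟨0, by simp, by simp⟩
  | succ d ih =>
    have hdN : d < N := by omega
    set e : F := t ⟨d, hdr⟩ / L ⟨d, hdN⟩ ⟨d, hdr⟩ with he
    have hL := hL1 ⟨d, hdN⟩ ⟨d, hdr⟩ rfl hdm
    obtain ⟨x, h1, h2⟩ := ih (by omega) (by omega) (fun p => t p - e * L ⟨d, hdN⟩ p)
    refine ⟨x + Pi.single ⟨d, hdN⟩ e, ?_, ?_⟩
    · intro a ha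
      rw [Pi.add_apply, h1 a (by omega), Pi.single_eq_of_ne, add_zero]
      rintro rfl
      simp only at ha
      omega
    · intro p
      rw [add_vecMul, Pi.add_apply, h2, single_vecMul, Pi.smul_apply, smul_eq_mul, row_apply]
      rcases lt_trichotomy (p : ℕ) d with h | h | h
      · rw [if_pos h, if_pos (by omega), sub_add_cancel]
      · have hp : p = ⟨d, hdr⟩ := Fin.ext h
        rw [if_neg (by omega), if_pos (by omega), hp, he, zero_add, div_mul_cancel₀ _ hL]
      · rw [if_neg (by omega), if_neg (by omega), hL0 _ _ (by exact h), mul_zero, zero_add]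

theorem exists_elimination {L : Matrix (Fin N) (Fin r) F}
    (hL0 : ∀ (b : Fin N) (p : Fin r), (b : ℕ) < p → L b p = 0) (hm : m ≤ N)
    (hL1 : ∀ (b : Fin N) (p : Fin r), (p : ℕ) = b → (b : ℕ) < m → L b p ≠ 0)
    (K : ℕ → ℕ → Prop) (hK : ∀ b a, K b a → a < b) (hK' : ∀ b a a', K b a → a' ≤ a → K b a') :
    ∃ T : Matrix (Fin N) (Fin N) F, (∀ b a : Fin N, T b a ≠ 0 → K b a ∧ (b : ℕ) < m) ∧
      ∀ (b : Fin N) (p : Fin r), (b : ℕ) < m → (K b p → ((1 + T) * L : Matrix (Fin N) (Fin r) F) b p = 0) ∧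
        (¬ K b p → ((1 + T) * L : Matrix (Fin N) (Fin r) F) b p = L b p) := by
  classical
  -- The entries to be cleared in a row form an initial segment, so rows above suffice and the
  -- entries to be kept are untouched.
  have hd : ∀ b : ℕ, ∃ d ≤ b, ∀ a, K b a ↔ a < d := by
    intro b
    have hex : ∃ d, ¬ K b d := ⟨b, fun h => lt_irrefl _ (hK b b h)⟩
    refine ⟨Nat.find hex, Nat.find_min' hex fun h => lt_irrefl _ (hK b b h), fun a => ?_⟩
    constructor
    · intro h
      by_contra h'
      exact Nat.find_spec hex (hK' b a _ h (not_lt.1 h'))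
    · intro h
      by_contra h'
      exact absurd h (Nat.find_min' hex h').not_gt
  choose d hdb hd using hd
  have hrow : ∀ b : Fin N, ∃ x : Fin N → F, (∀ a, x a ≠ 0 → K b a ∧ (b : ℕ) < m) ∧
      ((b : ℕ) < m → ∀ p : Fin r, (x ᵥ* L) p = if K b p then - L b p else 0) := by
    intro b
    by_cases hb : (b : ℕ) < m
    · obtain ⟨x, h1, h2⟩ := exists_row_combination hL0 hm hL1 (min (d b) r)
        ((min_le_left _ _).trans ((hdb b).trans hb.le)) (min_le_right _ _) (fun p => - L b p)
      refine ⟨x, fun a ha => ⟨(hd b a).2 ?_, hb⟩, fun _ p => ?_⟩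
      · by_contra h
        exact ha (h1 a ((min_le_left _ _).trans (not_lt.1 h)))
      · rw [h2 p]
        simp [hd b p]
    · exact ⟨0, by simp, fun h => absurd h hb⟩
  choose x hx1 hx2 using hrow
  refine ⟨of x, fun b a h => hx1 b a h, fun b p hb => ?_⟩
  have h3 : ((1 + of x) * L : Matrix (Fin N) (Fin r) F) b p = L b p + (x b ᵥ* L) p := by
    rw [Matrix.add_mul, Matrix.one_mul]
    rfl
  rw [h3, hx2 b hb p]
  constructor
  · intro h
    rw [if_pos h, add_neg_cancel]
  · intro h
    rw [if_neg h, add_zero]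

end Elimination

/-! ### Nonvanishing of generic minors -/

section Generic

variable {k L : Type*} [Field k] [Field L] [Algebra k L] {ι κ : Type*} [Fintype ι]

/-- The determinant is a polynomial over `k` in the entries of `z`. Specialising the selected
columns to those of `B` gives the value `1`, so the polynomial is nonzero and independence keeps its
value at `z` nonzero. -/
theorem det_ne_zero_of_algebraicIndependent {z : Matrix ι κ L}
    (hz : AlgebraicIndependent k fun s : ι × κ => z s.1 s.2) {q : ℕ} {A : Matrix (Fin q) ι k}
    {B : Matrix ι (Fin q) k} (hAB : A * B = 1) {e : Fin q → κ} (he : Function.Injective e) :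
    ((A.map (algebraMap k L) * z).submatrix id e).det ≠ 0 := by
  let A' : Matrix (Fin q) ι (MvPolynomial (ι × κ) k) := A.map MvPolynomial.C
  let X' : Matrix ι κ (MvPolynomial (ι × κ) k) := of fun i p => MvPolynomial.X (i, p)
  let P : Matrix (Fin q) (Fin q) (MvPolynomial (ι × κ) k) := (A' * X').submatrix id e
  have hdet : P.det ≠ 0 := by
    intro h0
    have h1 := congrArg (MvPolynomial.eval fun s : ι × κ => Function.extend e (B s.1) 0 s.2) h0
    rw [RingHom.map_det, map_zero] at h1
    have h2 : (MvPolynomial.eval fun s : ι × κ =>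
        Function.extend e (B s.1) 0 s.2).mapMatrix P = 1 := by
      rw [← hAB]
      ext i j
      simp [P, A', X', Matrix.mul_apply, he.extend_apply]
    rw [h2, det_one] at h1
    exact one_ne_zero h1
  intro h0
  apply hdet
  apply hz
  rw [map_zero, AlgHom.map_det, ← h0]
  congr 1
  ext i j
  simp [P, A', X', Matrix.mul_apply]

theorem submatrix_map_mul_det_ne_zero {z : Matrix ι κ L} {N m : ℕ}
    (hz : AlgebraicIndependent k fun s : ι × κ => z s.1 s.2) {A : Matrix (Fin N) ι k}
    {B : Matrix ι (Fin N) k} (hAB : A * B = levelProj N k m) {q : ℕ} {f : Fin q → Fin N}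
    (hf : Function.Injective f) (hfm : ∀ i, (f i : ℕ) < m) {e : Fin q → κ}
    (he : Function.Injective e) :
    ((A.map (algebraMap k L) * z).submatrix f e).det ≠ 0 := by
  refine det_ne_zero_of_algebraicIndependent (A := A.submatrix f id) (B := B.submatrix id f) hz
    ?_ he
  ext i j
  have h1 : (A.submatrix f id * B.submatrix id f) i j = (A * B) (f i) (f j) := rfl
  rw [h1, hAB, levelProj, diagonal_apply, Matrix.one_apply]
  simp [hf.eq_iff, hfm]

end Generic

/-! ### Base change to a larger field -/

section Map

variable {k L : Type*} [Field k] [Field L] (f : k →+* L) {ι : Type*} [Fintype ι] [DecidableEq ι]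
  {N m : ℕ}

theorem levelProj_map : (levelProj N k m).map f = levelProj N L m := by
  ext i j
  by_cases hij : i = j
  · subst hij
    by_cases hi : (i : ℕ) < m <;> simp [levelProj, hi]
  · simp [levelProj, diagonal_apply_ne _ hij]

theorem IsCokernel.map {x : Matrix ι ι k} {π : Matrix (Fin N) ι k} {τ : Matrix ι (Fin N) k}
    (h : IsCokernel x m π τ) : IsCokernel (x.map f) m (π.map f) (τ.map f) := by
  obtain ⟨s, hs⟩ := h.split
  refine ⟨?_, ⟨s.map f, ?_⟩, ?_⟩
  · rw [← Matrix.map_mul, h.mul_eq_zero, Matrix.map_zero _ (map_zero f)]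
  · rw [← Matrix.map_mul, ← Matrix.map_mul, ← Matrix.map_add _ (map_add f), hs,
      Matrix.map_one _ (map_zero f) (map_one f)]
  · rw [← Matrix.map_mul, h.proj, levelProj_map]

theorem Realizes.map {R : ι → ι → Prop} {x : Matrix ι ι k} {π : Matrix (Fin N) ι k} {b a : Fin N}
    (h : Realizes (supportedOn k R) x π (single b a 1)) :
    Realizes (supportedOn L R) (x.map f) (π.map f) (single b a 1) := by
  obtain ⟨θ, h1, h2, h3⟩ := h
  refine ⟨θ.map f, fun i j hij => by rw [map_apply, h1 i j hij, map_zero], ?_, ?_⟩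
  · rw [← Matrix.map_mul, h2, Matrix.map_mul]
  · rw [← Matrix.map_mul, h3, Matrix.map_mul, map_single, map_one]

theorem Blocks.BlockState.map {D : Blocks ι} {y : Matrix ι ι k} {σ : Matrix (Fin N) ι k}
    {τ : Matrix ι (Fin N) k} (h : D.BlockState m y σ τ) :
    D.BlockState m (y.map f) (σ.map f) (τ.map f) :=
  ⟨h.coker.map f, fun b a h1 h2 => (h.realizes b a h1 h2).map f⟩

theorem Blocks.RowState.map {D : Blocks ι} {r : ℕ → ℕ} {s : ℕ} {y : Matrix ι ι k}
    {π : Matrix (Fin N) ι k} (h : D.RowState r s m y π) :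
    D.RowState r s m (y.map f) (π.map f) := by
  refine ⟨?_, fun i b a h1 h2 h3 => (h.realizes i b a h1 h2 h3).map f⟩
  have h1 : (D.rowMatrix k r s N).map f = D.rowMatrix L r s N := by
    classical
    ext i b
    simp only [rowMatrix, map_apply, of_apply]
    split_ifs <;> simp
  rw [← h1]
  exact h.coker.map f

end Map

/-! ### Change of coordinates by commuting matrices and column operations -/

section Conj

variable {F : Type*} [Field F] {ι : Type*} [Fintype ι] [DecidableEq ι] {N m r : ℕ}

theorem Blocks.BlockState.conj {D : Blocks ι} {y : Matrix ι ι F} {σ : Matrix (Fin N) ι F}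
    {τ : Matrix ι (Fin N) F} (h : D.BlockState m y σ τ) {g g' : Matrix ι ι F} (hgg : g * g' = 1)
    (hg : g ∈ D.parabolic F) (hg' : g' ∈ D.parabolic F) (hgy : g * y = y * g) :
    D.BlockState m y (σ * g') (g * τ) := by
  have hgg' : g' * g = 1 := mul_eq_one_comm.1 hgg
  have hgy' : g' * y = y * g' := by
    calc g' * y = g' * (y * g) * g' := by
          rw [Matrix.mul_assoc, Matrix.mul_assoc y, hgg, Matrix.mul_one]
      _ = y * g' := by rw [← hgy, ← Matrix.mul_assoc, hgg', Matrix.one_mul]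
  obtain ⟨s, hs⟩ := h.coker.split
  refine ⟨⟨?_, ⟨g * s * g', ?_⟩, ?_⟩, fun b a hab hb => ?_⟩
  · rw [Matrix.mul_assoc, hgy', ← Matrix.mul_assoc, h.coker.mul_eq_zero, Matrix.zero_mul]
  · calc y * (g * s * g') + g * τ * (σ * g') = g * (y * s + τ * σ) * g' := by
          rw [Matrix.mul_add, Matrix.add_mul, ← Matrix.mul_assoc g y, hgy]
          simp only [Matrix.mul_assoc]
      _ = 1 := by rw [hs, Matrix.mul_one, hgg]
  · rw [Matrix.mul_assoc, ← Matrix.mul_assoc g', hgg', Matrix.one_mul, h.coker.proj]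
  · obtain ⟨θ, h1, h2, h3⟩ := h.realizes b a hab hb
    have hmul : ∀ {A B : Matrix ι ι F}, A ∈ D.parabolic F → B ∈ D.parabolic F →
        A * B ∈ D.parabolic F :=
      fun hA hB => mul_mem_supportedOn (fun i j l (h1 : D.blk i ≤ D.blk j) (h2 : D.blk j ≤ D.blk l) =>
        h1.trans h2) hA hB
    refine ⟨g * θ * g', hmul (hmul hg h1) hg', ?_, ?_⟩
    · rw [Matrix.mul_assoc, hgy', ← Matrix.mul_assoc, Matrix.mul_assoc g, h2, ← Matrix.mul_assoc,
        hgy]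
      simp only [Matrix.mul_assoc]
    · calc σ * g' * (g * θ * g') = σ * (g' * g) * θ * g' := by simp only [Matrix.mul_assoc]
        _ = single b a (1 : F) * (σ * g') := by
          rw [hgg', Matrix.mul_one, h3, Matrix.mul_assoc]

/-- Column operations on the new block are absorbed here, so adapted data may be found for the
generic columns and carried over to the normalised ones. -/
theorem Adapted.mul_right {c : Matrix (Fin N) (Fin r) F} {w : Matrix (Fin r) (Fin N) F}
    {Z : Matrix (Fin N) (Fin r) F} {Z' : Matrix (Fin r) (Fin N) F} (h : Adapted m r c w Z Z')
    {V V' : Matrix (Fin r) (Fin r) F} (hV : V * V' = 1) :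
    Adapted m r (c * V') (V * w) (Z * V') (V * Z') := by
  have hV' : V' * V = 1 := mul_eq_one_comm.1 hV
  have hcw : ∀ {A : Matrix (Fin N) (Fin r) F} {B : Matrix (Fin r) (Fin N) F},
      A * V' * (V * B) = A * B := by
    intro A B
    rw [Matrix.mul_assoc, ← Matrix.mul_assoc V', hV', Matrix.one_mul]
  refine ⟨⟨?_, ?_, ?_, ?_, ?_⟩, ?_, ?_⟩
  · rw [hcw, ← Matrix.mul_assoc, h.regular]
  · rw [hcw, h.levelProj_mul]
  · rw [Matrix.mul_assoc, h.mul_levelProj]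
  · rw [Matrix.mul_assoc, h.mul_levelProj']
  · rw [hcw]
    refine h.eq_zero_or.imp_right fun h1 => ?_
    rw [Matrix.mul_assoc, ← Matrix.mul_assoc w, h1, Matrix.one_mul, hV]
  · rw [Matrix.mul_assoc, ← Matrix.mul_assoc Z', h.left_inv, Matrix.one_mul, hV]
  · rw [hcw, h.right_inv]

end Conj

/-! ### The inductive step: adjoining one block -/

section Step

variable {ι : Type*} [Fintype ι] [DecidableEq ι]

/-- The positions of the base and its extension. -/
def Blocks.InExt (D : Blocks ι) (r : ℕ → ℕ) (i j : ι) : Prop :=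
  D.blk i < D.blk j ∧ (∀ s, D.blk i < s → s < D.blk j → r s ≤ D.pos j) ∧
    (D.rev i = D.pos j ∨ D.pos j < D.rev i ∧ ∃ s < D.blk i, D.pos i < r s)

/-- Matrices whose nonzero entries are exactly in the positions of the extended base. -/
def Blocks.Normal {F : Type*} [Field F] (D : Blocks ι) (r : ℕ → ℕ) (y : Matrix ι ι F) : Prop :=
  ∀ i j, (D.InExt r i j → y i j ≠ 0) ∧ (¬ D.InExt r i j → y i j = 0)

theorem Blocks.Normal.mem_nil {F : Type*} [Field F] {D : Blocks ι} {r : ℕ → ℕ} {y : Matrix ι ι F}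
    (h : D.Normal r y) : y ∈ D.nil F :=
  fun i j hij => (h i j).2 fun h' => hij h'.1

/-- `D` describes `k` blocks with `R` elements altogether, the largest of size `m`. -/
structure Blocks.Valid (D : Blocks ι) (r : ℕ → ℕ) (k R m : ℕ) : Prop where
  blk_lt : ∀ i, D.blk i < k
  ord_lt : ∀ i, D.ord i < R
  ord_injective : Function.Injective D.ord
  ord_lt_ord : ∀ i j, D.blk i < D.blk j → D.ord i < D.ord j
  rev_lt : ∀ i, D.rev i < m
  max_le : ∀ M, (∀ s < k, r s ≤ M) → m ≤ M
  final_unique : ∀ i j, D.Final r k i → D.Final r k j → D.rev i = D.rev j → i = j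

theorem Blocks.Valid.extend {D : Blocks ι} {r : ℕ → ℕ} {k R m : ℕ} (h : D.Valid r k R m) :
    (D.extend k R (r k)).Valid r (k + 1) (R + r k) (max m (r k)) := by
  have hrr : ∀ p : Fin (r k), r k - 1 - (p : ℕ) < r k := fun p => by have := p.2; omega
  refine ⟨?_, ?_, ?_, ?_, ?_, ?_, ?_⟩
  · rintro (i | p)
    · exact (h.blk_lt i).trans k.lt_succ_self
    · exact k.lt_succ_self
  · rintro (i | p)
    · exact (h.ord_lt i).trans_le (Nat.le_add_right _ _)
    · exact Nat.add_lt_add_left p.2 R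
  · rintro (i | p) (j | q) hij
    · exact congrArg Sum.inl (h.ord_injective hij)
    · have h1 : D.ord i = R + q := hij
      have := h.ord_lt i
      omega
    · have h1 : R + p = D.ord j := hij
      have := h.ord_lt j
      omega
    · have h1 : R + (p : ℕ) = R + q := hij
      exact congrArg Sum.inr (Fin.ext (by omega))
  · rintro (i | p) (j | q) hij
    · exact h.ord_lt_ord i j hij
    · exact (h.ord_lt i).trans_le (Nat.le_add_right _ _)
    · exact absurd ((h.blk_lt j).trans hij) (lt_irrefl _)
    · exact absurd hij (lt_irrefl k)
  · rintro (i | p)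
    · exact (h.rev_lt i).trans_le (le_max_left _ _)
    · exact (hrr p).trans_le (le_max_right _ _)
  · intro M hM
    exact _root_.max_le (h.max_le M fun s hs => hM s (hs.trans k.lt_succ_self)) (hM k k.lt_succ_self)
  · rintro (i | p) (j | q) hi hj hij
    · exact congrArg Sum.inl (h.final_unique i j
        (fun s h1 h2 => hi s h1 (h2.trans k.lt_succ_self))
        (fun s h1 h2 => hj s h1 (h2.trans k.lt_succ_self)) hij)
    · have h1 : r k ≤ D.rev i := hi k (h.blk_lt i) k.lt_succ_self
      have h2 : D.rev i = r k - 1 - q := hij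
      have := hrr q
      omega
    · have h1 : r k ≤ D.rev j := hj k (h.blk_lt j) k.lt_succ_self
      have h2 : r k - 1 - p = D.rev j := hij
      have := hrr p
      omega
    · have h1 : r k - 1 - (p : ℕ) = r k - 1 - q := hij
      have := p.2
      have := q.2
      exact congrArg Sum.inr (Fin.ext (by omega))

theorem Blocks.det_one_add_strict {F : Type*} [Field F] {D : Blocks ι}
    (hD : Function.Injective D.ord) {θ : Matrix ι ι F} (hθ : θ ∈ D.strict F) :
    (1 + θ).det = 1 := by
  let _ : LinearOrder ι := LinearOrder.lift' D.ord hD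
  have h1 : (1 + θ).IsUpperTriangular := by
    intro i j hij
    have hji : D.ord j < D.ord i := hij
    rw [Matrix.add_apply, hθ i j hji.not_gt, one_apply_ne (by rintro rfl; exact lt_irrefl _ hji),
      add_zero]
  rw [det_of_isUpperTriangular h1]
  exact Finset.prod_eq_one fun i _ => by
    rw [Matrix.add_apply, hθ i i (lt_irrefl _), one_apply_eq, add_zero]

/-- In a row without earlier base element, the entries on or below the diagonal of the cokernel
coordinates that are not removable are exactly those of the extended base. The other rows have no
position of the extended base in the new block. -/
theorem Blocks.Normal.extend {F : Type*} [Field F] {D : Blocks ι} {r : ℕ → ℕ} {k R m N : ℕ}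
    (hD : D.Valid r k R m) (hm : m ≤ N) {y : Matrix ι ι F} (hy : D.Normal r y)
    {c : Matrix (Fin N) (Fin (r k)) F}
    (hc0 : ∀ (b : Fin N) (p : Fin (r k)), (b : ℕ) < p → c b p = 0)
    (hc1 : ∀ (b : Fin N) (p : Fin (r k)) (i : ι), D.Final r k i → D.rev i = b → D.Kill r k i p →
      c b p = 0)
    (hc2 : ∀ (b : Fin N) (p : Fin (r k)) (i : ι), D.Final r k i → D.rev i = b →
      ¬ D.Kill r k i p → (p : ℕ) ≤ b → c b p ≠ 0) :
    (D.extend k R (r k)).Normal r (fromBlocks y (D.rowMatrix F r k N * c) 0 0) := by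
  classical
  rintro (i | p) (j | q)
  · exact hy i j
  · have hext : (D.extend k R (r k)).InExt r (Sum.inl i) (Sum.inr q) ↔ D.blk i < k ∧
        (∀ s, D.blk i < s → s < k → r s ≤ q) ∧
        (D.rev i = q ∨ (q : ℕ) < D.rev i ∧ ∃ s < D.blk i, D.pos i < r s) := Iff.rfl
    have hiN : D.rev i < N := (hD.rev_lt i).trans_le hm
    rw [hext, fromBlocks_apply₁₂]
    have hval : (D.rowMatrix F r k N * c) i q
        = if D.Final r k i then c ⟨D.rev i, hiN⟩ q else 0 := by
      rw [Matrix.mul_apply, Finset.sum_eq_single ⟨D.rev i, hiN⟩]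
      · by_cases hF : D.Final r k i <;> simp [rowMatrix, hF]
      · intro b _ hb
        simp only [rowMatrix, of_apply]
        rw [if_neg, zero_mul]
        rintro ⟨-, h2⟩
        exact hb (Fin.ext h2.symm)
      · simp
    rw [hval]
    by_cases hF : D.Final r k i
    · rw [if_pos hF]
      rcases lt_or_ge (D.rev i) (q : ℕ) with hlt | hge
      · refine ⟨fun h => ?_, fun _ => hc0 _ _ hlt⟩
        rcases h.2.2 with h1 | h1 <;> omega
      · have hiff : D.Kill r k i q ↔ ¬ (D.blk i < k ∧ (∀ s, D.blk i < s → s < k → r s ≤ q) ∧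
            (D.rev i = q ∨ (q : ℕ) < D.rev i ∧ ∃ s < D.blk i, D.pos i < r s)) := by
          constructor
          · rintro ⟨h1, h2⟩ ⟨-, h3, h4⟩
            rcases h4 with h4 | ⟨-, s, h5, h6⟩
            · omega
            · rcases h2 with h2 | ⟨s', h7, h8, h9⟩
              · exact absurd (h2 s h5) h6.not_ge
              · exact absurd (h3 s' h7 h8) h9.not_ge
          · intro h
            rcases eq_or_lt_of_le hge with heq | hlt
            · exact absurd ⟨hD.blk_lt i, fun s h1 h2 => heq ▸ hF s h1 h2, Or.inl heq.symm⟩ h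
            · refine ⟨hlt, ?_⟩
              by_contra hno
              push Not at hno
              obtain ⟨⟨s, h1, h2⟩, h3⟩ := hno
              exact h ⟨hD.blk_lt i, h3, Or.inr ⟨hlt, s, h1, h2⟩⟩
        constructor
        · intro h
          exact hc2 ⟨D.rev i, hiN⟩ q i hF rfl (fun h' => hiff.1 h' h) hge
        · intro h
          exact hc1 ⟨D.rev i, hiN⟩ q i hF rfl (hiff.2 h)
    · rw [if_neg hF]
      refine ⟨fun h => absurd ?_ hF, fun _ => rfl⟩
      intro s h1 h2
      refine (h.2.1 s h1 h2).trans ?_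
      rcases h.2.2 with h3 | h3 <;> omega
  · exact ⟨fun h => absurd (h.1.trans (hD.blk_lt j)) (lt_irrefl k), fun _ => rfl⟩
  · exact ⟨fun h => absurd h.1 (lt_irrefl k), fun _ => rfl⟩

/-- Everything about the earlier blocks is defined over the small field `k`, over which the new
columns are independent. This allows generic position to be used for the coordinates `π` and `σ` at
once. -/
theorem exists_normal_extension {k L : Type*} [Field k] [Field L] [Algebra k L] {D : Blocks ι}
    {r : ℕ → ℕ} {s R m N : ℕ} (hD : D.Valid r s R m) (hm : m ≤ N) (hr : r s ≤ N)
    {x g y : Matrix ι ι k} (hg : BlockTriangular g D.ord) (hgu : IsUnit g.det)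
    (hgx : g * x = y * g) {σ : Matrix (Fin N) ι k} {τ : Matrix ι (Fin N) k}
    (hσ : D.BlockState m y σ τ) {π : Matrix (Fin N) ι k} (hπ : D.RowState r s m y π)
    (hy : D.Normal r y) {z : Matrix ι (Fin (r s)) L}
    (hz : AlgebraicIndependent k fun q : ι × Fin (r s) => z q.1 q.2) :
    ∃ g' y' : Matrix (ι ⊕ Fin (r s)) (ι ⊕ Fin (r s)) L,
      BlockTriangular g' (D.extend s R (r s)).ord ∧ IsUnit g'.det ∧
      g' * fromBlocks (x.map (algebraMap k L)) z 0 0 = y' * g' ∧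
      (∃ (σ' : Matrix (Fin N) (ι ⊕ Fin (r s)) L) (τ' : Matrix (ι ⊕ Fin (r s)) (Fin N) L),
        (D.extend s R (r s)).BlockState (max m (r s)) y' σ' τ') ∧
      (∃ π' : Matrix (Fin N) (ι ⊕ Fin (r s)) L,
        (D.extend s R (r s)).RowState r (s + 1) (max m (r s)) y' π') ∧
      (D.extend s R (r s)).Normal r y' := by
  set f := algebraMap k L with hf
  have hminors : ∀ {A : Matrix (Fin N) ι k} {B : Matrix ι (Fin N) k}, A * B = levelProj N k m →
      ∀ {q : ℕ} {e : Fin q → Fin N}, Function.Injective e → (∀ i, (e i : ℕ) < m) →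
      ∀ {e' : Fin q → Fin (r s)}, Function.Injective e' →
      ((A.map f * (g.map f * z)).submatrix e e').det ≠ 0 := by
    intro A B hAB q e he hem e' he'
    -- The earlier conjugation `g` is invertible over `k`, so it does not spoil genericity.
    have h1 : A * g * (g⁻¹ * B) = levelProj N k m := by
      rw [Matrix.mul_assoc, ← Matrix.mul_assoc g, mul_nonsing_inv g hgu, Matrix.one_mul, hAB]
    rw [← Matrix.mul_assoc, ← Matrix.map_mul]
    exact submatrix_map_mul_det_ne_zero hz h1 he hem he'
  have hπ' := hπ.map f
  have hσ' := hσ.map f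
  set Y := y.map f with hY
  set P := π.map f with hP
  set Sg := σ.map f with hSg
  set z₁ := g.map f * z with hz₁
  have hYnil : Y ∈ D.nil L := fun i j hij => by
    rw [hY, map_apply, hy.mem_nil i j hij, map_zero]
  have hYnorm : D.Normal r Y := fun i j =>
    ⟨fun h => by rw [hY, map_apply]; exact (map_ne_zero f).2 ((hy i j).1 h),
      fun h => by rw [hY, map_apply, (hy i j).2 h, map_zero]⟩
  have hc : levelProj N L m * (P * z₁) = P * z₁ := by
    rw [← Matrix.mul_assoc, hπ'.coker.levelProj_mul]
  obtain ⟨Lo, V, hLV, hVt, hVu, hL0, hL1⟩ := exists_lower_upper hm hc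
    (fun q h1 h2 => hminors hπ.coker.proj (e := Fin.castLE (h1.trans hm)) (Fin.castLE_injective _)
      (fun i => lt_of_lt_of_le i.2 h1) (Fin.castLE_injective _))
    (fun p hp hpN b hpb hbm => hminors hπ.coker.proj
      (Fin.snoc_injective_iff.2 ⟨Fin.castLE_injective _, by
        rintro ⟨i, hi⟩
        have := congrArg Fin.val hi
        simp only [Fin.val_castLE] at this
        omega⟩)
      (fun i => by
        refine Fin.lastCases ?_ (fun j => ?_) i
        · rw [Fin.snoc_last]
          exact hbm
        · rw [Fin.snoc_castSucc]
          have := j.2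
          simp only [Fin.val_castLE]
          omega) (Fin.castLE_injective _))
  have hV1 : V * V⁻¹ = 1 := mul_nonsing_inv V hVu
  obtain ⟨T, hT, hTL⟩ := exists_elimination hL0 hm (fun b p h1 h2 => hL1 b p h1.le h2)
    (fun b a => ∃ i, D.Final r s i ∧ D.rev i = b ∧ D.Kill r s i a)
    (by
      rintro b a ⟨i, -, h2, h3⟩
      exact h2 ▸ h3.1)
    (by
      rintro b a a' ⟨i, h1, h2, h3⟩ haa
      refine ⟨i, h1, h2, lt_of_le_of_lt haa h3.1, h3.2.imp_right ?_⟩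
      rintro ⟨t, h4, h5, h6⟩
      exact ⟨t, h4, h5, lt_of_le_of_lt haa h6⟩)
  obtain ⟨θ, hθ1, hθ2, hθ3⟩ : Realizes (D.strict L) Y P T := by
    refine realizes_of_single fun b a hba => ?_
    obtain ⟨⟨i, h1, h2, h3⟩, -⟩ := hT b a hba
    exact hπ'.realizes i b a h1 h2 h3
  set h : Matrix ι ι L := 1 + θ with hh
  have hdet : h.det = 1 := Blocks.det_one_add_strict hD.ord_injective hθ1
  have hhu : IsUnit h.det := by rw [hdet]; exact isUnit_one
  have hhY : h * Y = Y * h := by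
    rw [hh, Matrix.add_mul, Matrix.mul_add, hθ2, Matrix.one_mul, Matrix.mul_one]
  set c : Matrix (Fin N) (Fin (r s)) L := (1 + T) * Lo with hcdef
  have hLm : levelProj N L m * Lo = Lo := by
    have h1 : Lo = P * z₁ * V⁻¹ := by rw [hLV, Matrix.mul_assoc, hV1, Matrix.mul_one]
    rw [h1, ← Matrix.mul_assoc, hc]
  have hcm : levelProj N L m * c = c := by
    have h1 : levelProj N L m * T = T := by
      ext b a
      rw [levelProj_mul_apply]
      split_ifs with hb
      · rfl
      · by_contra hne
        exact hb (hT b a (Ne.symm hne)).2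
    rw [hcdef, Matrix.add_mul, Matrix.mul_add, Matrix.one_mul, hLm, ← Matrix.mul_assoc, h1]
  have hcL : ∀ (b : Fin N) (p : Fin (r s)) (i : ι), D.Final r s i → D.rev i = b →
      ((D.Kill r s i p → c b p = 0) ∧ (¬ D.Kill r s i p → c b p = Lo b p)) := by
    intro b p i hF hb
    have h1 := hTL b p (hb ▸ hD.rev_lt i)
    refine ⟨fun h2 => h1.1 ⟨i, hF, hb, h2⟩, fun h2 => h1.2 ?_⟩
    rintro ⟨j, hj, hjb, hjK⟩
    rw [hD.final_unique j i hj hF (hjb.trans hb.symm)] at hjK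
    exact h2 hjK
  have hc0 : ∀ (b : Fin N) (p : Fin (r s)), (b : ℕ) < p → c b p = 0 := by
    intro b p hbp
    rcases lt_or_ge (b : ℕ) m with hb | hb
    · rw [(hTL b p hb).2, hL0 b p hbp]
      rintro ⟨i, -, h2, h3⟩
      have := h3.1
      omega
    · rw [← hcm, levelProj_mul_apply, if_neg hb.not_gt]
  set zf := D.rowMatrix L r s N * c with hzf
  have hPz : P * zf = c := by rw [hzf, ← Matrix.mul_assoc, hπ'.coker.proj, hcm]
  -- Both terms have class `(1 + T) * Lo * V` in the cokernel; their difference is absorbed by a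
  -- unipotent conjugation with `v`.
  obtain ⟨v, hv⟩ := hπ'.coker.exists_eq_mul (Y := h * z₁ - zf * V) (by
    rw [Matrix.mul_sub, ← Matrix.mul_assoc P h z₁, ← Matrix.mul_assoc P zf V, hPz, hh,
      Matrix.mul_add, Matrix.mul_one, hθ3, Matrix.add_mul, Matrix.mul_assoc T P z₁, hLV, hcdef,
      Matrix.mul_assoc (1 + T) Lo V, Matrix.add_mul, Matrix.one_mul, sub_self])
  have hhpar : h ∈ D.parabolic L := by
    intro i j hij
    have h1 := hD.ord_lt_ord j i (not_le.1 hij)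
    rw [hh, Matrix.add_apply, hθ1 i j h1.not_gt, one_apply_ne (by rintro rfl; exact hij le_rfl),
      add_zero]
  have hhpar' : h⁻¹ ∈ D.parabolic L := by
    have := invertibleOfIsUnitDet h hhu
    have h1 : BlockTriangular h D.blk := fun i j hij => hhpar i j (not_le.2 hij)
    exact fun i j hij => blockTriangular_inv_of_blockTriangular h1 (not_le.1 hij)
  have hσ'' := hσ'.conj (mul_nonsing_inv h hhu) hhpar hhpar' hhY
  -- In the coordinates moved by `h` the normalised columns are the generic ones up to `V`, so
  -- genericity can be used for `BlockState` although the normalised columns are sparse.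
  have hSz : Sg * h⁻¹ * zf = Sg * z₁ * V⁻¹ := by
    have hhY' : h⁻¹ * Y = Y * h⁻¹ := by
      calc h⁻¹ * Y = h⁻¹ * (Y * h) * h⁻¹ := by
            rw [Matrix.mul_assoc, Matrix.mul_assoc Y, mul_nonsing_inv h hhu, Matrix.mul_one]
        _ = Y * h⁻¹ := by
            rw [← hhY, ← Matrix.mul_assoc, nonsing_inv_mul h hhu, Matrix.one_mul]
    have h1 : zf * V = h * z₁ - Y * v := by rw [← hv]; abel
    have h2 : Sg * h⁻¹ * (zf * V) = Sg * z₁ := by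
      rw [h1, Matrix.mul_sub, Matrix.mul_assoc Sg, ← Matrix.mul_assoc h⁻¹,
        nonsing_inv_mul h hhu, Matrix.one_mul, Matrix.mul_assoc Sg, ← Matrix.mul_assoc h⁻¹, hhY',
        Matrix.mul_assoc Y, ← Matrix.mul_assoc Sg Y, hσ'.coker.mul_eq_zero, Matrix.zero_mul,
        sub_zero]
    rw [← h2, Matrix.mul_assoc (Sg * h⁻¹), Matrix.mul_assoc zf V, hV1, Matrix.mul_one]
  obtain ⟨w, hw, hw'⟩ := exists_quasiInverse hm (c := Sg * z₁)
    (by rw [← Matrix.mul_assoc, hσ'.coker.levelProj_mul])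
    (hminors hσ.coker.proj (e := Fin.castLE ((min_le_left m (r s)).trans hm))
      (e' := Fin.castLE (min_le_right m (r s))) (Fin.castLE_injective _)
      (fun i => lt_of_lt_of_le i.2 (min_le_left _ _)) (Fin.castLE_injective _))
  obtain ⟨Z, Z', hA, hZ', hZ⟩ := hw.exists_adapted hr hw'
  have hA' := hA.mul_right hV1
  have hVV : ∀ {A : Matrix (Fin N) (Fin (r s)) L} {B : Matrix (Fin (r s)) (Fin N) L},
      A * V⁻¹ * (V * B) = A * B := by
    intro A B
    rw [Matrix.mul_assoc, ← Matrix.mul_assoc V⁻¹, nonsing_inv_mul V hVu, Matrix.one_mul]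
  rw [← hSz] at hA'
  have hblock := hσ''.extend (R := R) hD.blk_lt hYnil hA' (by
    rw [hSz, hVV, hVV, hZ']) (by
    intro a h1 h2 p
    rw [hSz, Matrix.mul_apply, Matrix.mul_apply]
    exact Finset.sum_congr rfl fun q _ => by rw [hZ a h1 h2 q])
  have hlift := exists_commute_lift hσ''.coker hA' hσ''.realizes
  -- The elimination clears only entries strictly below the diagonal, so the diagonal of `Lo`
  -- survives.
  have hcdet : (c.submatrix (Fin.castLE ((min_le_left m (r s)).trans hm))
      (Fin.castLE (min_le_right m (r s)))).det ≠ 0 := by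
    have htri : (c.submatrix (Fin.castLE ((min_le_left m (r s)).trans hm))
        (Fin.castLE (min_le_right m (r s)))).IsLowerTriangular := by
      intro i j hij
      have hij' : i < j := hij
      exact hc0 _ _ (Fin.lt_def.1 hij')
    rw [det_of_isLowerTriangular _ htri]
    refine Finset.prod_ne_zero_iff.2 fun i _ => ?_
    have him : (i : ℕ) < m := lt_of_lt_of_le i.2 (min_le_left _ _)
    rw [submatrix_apply, (hTL _ _ him).2]
    · exact hL1 _ _ le_rfl him
    · rintro ⟨j, -, h2, h3⟩
      have := h3.1
      simp only [Fin.val_castLE] at h2 this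
      omega
  rw [← hPz] at hcdet hcm
  obtain ⟨w₂, hw₂, -⟩ := exists_quasiInverse hm hcm hcdet
  have hrow := hπ'.extend hD.blk_lt hD.ord_lt hD.ord_lt_ord hYnil hD.max_le hD.rev_lt hlift hw₂
    (by rw [hPz]; exact hc0) hr
  refine ⟨fromBlocks (h * g.map f) v 0 V, fromBlocks Y zf 0 0, ?_, ?_, ?_, ⟨_, _, hblock⟩,
    ⟨_, hrow⟩, ?_⟩
  · have hht : BlockTriangular h D.ord := by
      intro i j hij
      rw [hh, Matrix.add_apply, hθ1 i j hij.not_gt,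
        one_apply_ne (by rintro rfl; exact lt_irrefl _ hij), add_zero]
    rintro (i | p) (j | q) hij
    · exact (hht.mul (hg.map f)) hij
    · exact absurd (((hD.ord_lt i).trans_le (Nat.le_add_right _ _)).trans hij) (lt_irrefl _)
    · rfl
    · refine hVt ?_
      have h1 : R + (q : ℕ) < R + p := hij
      have h2 : (q : ℕ) < p := by omega
      exact Fin.lt_def.2 h2
  · rw [det_fromBlocks_zero₂₁, det_mul, hdet, one_mul]
    refine IsUnit.mul ?_ hVu
    have : (g.map f).det = f g.det := (RingHom.map_det f g).symm
    rw [this]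
    exact hgu.map f
  · simp only [fromBlocks_multiply, Matrix.mul_zero, Matrix.zero_mul, add_zero]
    congr 1
    · rw [Matrix.mul_assoc, ← Matrix.map_mul, hgx, Matrix.map_mul, ← Matrix.mul_assoc, hhY,
        Matrix.mul_assoc]
    · rw [← hv, Matrix.mul_assoc]
      abel
  · exact hYnorm.extend hD hm hc0 (fun b p i h1 h2 => (hcL b p i h1 h2).1)
      (fun b p i h1 h2 h3 h4 => by
        rw [(hcL b p i h1 h2).2 h3]
        exact hL1 b p h4 (h2 ▸ hD.rev_lt i))

end Step

/-! ### Induction over the blocks -/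

section Generic

/-- The index set of the first `k` blocks, of sizes `r 0, …, r (k - 1)`. -/
def Idx (r : ℕ → ℕ) : ℕ → Type
  | 0 => Empty
  | k + 1 => Idx r k ⊕ Fin (r k)

instance instFintypeIdx (r : ℕ → ℕ) : (k : ℕ) → Fintype (Idx r k)
  | 0 => inferInstanceAs (Fintype Empty)
  | k + 1 =>
    have := instFintypeIdx r k
    inferInstanceAs (Fintype (Idx r k ⊕ Fin (r k)))

instance instDecidableEqIdx (r : ℕ → ℕ) : (k : ℕ) → DecidableEq (Idx r k)
  | 0 => inferInstanceAs (DecidableEq Empty)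
  | k + 1 =>
    have := instDecidableEqIdx r k
    inferInstanceAs (DecidableEq (Idx r k ⊕ Fin (r k)))

/-- The number of elements of the first `k` blocks. -/
def partialSum (r : ℕ → ℕ) (k : ℕ) : ℕ := ∑ s ∈ Finset.range k, r s

/-- The size of the largest of the first `k` blocks. -/
def maxSize (r : ℕ → ℕ) : ℕ → ℕ
  | 0 => 0
  | k + 1 => max (maxSize r k) (r k)

/-- The positions of the elements of the first `k` blocks. -/
def blocks (r : ℕ → ℕ) : (k : ℕ) → Blocks (Idx r k)
  | 0 => ⟨Empty.elim, Empty.elim, Empty.elim, Empty.elim⟩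
  | k + 1 => (blocks r k).extend k (partialSum r k) (r k)

theorem blocks_valid (r : ℕ → ℕ) (k : ℕ) :
    (blocks r k).Valid r k (partialSum r k) (maxSize r k) := by
  induction k with
  | zero => exact ⟨nofun, nofun, nofun, nofun, nofun, fun _ _ => Nat.zero_le _, nofun⟩
  | succ k ih =>
    have h := ih.extend
    rw [partialSum, Finset.sum_range_succ]
    exact h

theorem card_idx (r : ℕ → ℕ) (k : ℕ) : Fintype.card (Idx r k) = partialSum r k := by
  induction k with
  | zero => rfl
  | succ k ih =>
    rw [partialSum, Finset.sum_range_succ]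
    refine (Fintype.card_sum (α := Idx r k) (β := Fin (r k))).trans ?_
    rw [ih, Fintype.card_fin, partialSum]

theorem blocks_pos (r : ℕ → ℕ) (k : ℕ) (i : Idx r k) :
    (blocks r k).ord i = partialSum r ((blocks r k).blk i) + (blocks r k).pos i ∧
      (blocks r k).pos i < r ((blocks r k).blk i) ∧
      (blocks r k).rev i = r ((blocks r k).blk i) - 1 - (blocks r k).pos i := by
  induction k with
  | zero => exact i.elim
  | succ k ih =>
    rcases i with i | p
    · exact ih i
    · exact ⟨rfl, p.2, rfl⟩

theorem le_maxSize (r : ℕ → ℕ) {s k : ℕ} (h : s < k) : r s ≤ maxSize r k := by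
  induction k with
  | zero => omega
  | succ k ih =>
    rcases Nat.lt_succ_iff_lt_or_eq.1 h with h1 | rfl
    · exact (ih h1).trans (le_max_left _ _)
    · exact le_max_right _ _

/-- The field `L` varies in the induction: the hypothesis is applied over the field generated by the
entries of the earlier blocks, and the last columns stay independent over it. -/
theorem exists_normal_form (k₀ : Type*) [Field k₀] (r : ℕ → ℕ) {N : ℕ} (k : ℕ)
    (hN : ∀ s < k, r s ≤ N) (L : Type*) [Field L] [Algebra k₀ L]
    (x : Matrix (Idx r k) (Idx r k) L) (hx : x ∈ (blocks r k).nil L)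
    (hind : AlgebraicIndependent k₀ fun γ : {γ : Idx r k × Idx r k //
      (blocks r k).blk γ.1 < (blocks r k).blk γ.2} => x γ.1.1 γ.1.2) :
    ∃ g y : Matrix (Idx r k) (Idx r k) L, BlockTriangular g (blocks r k).ord ∧ IsUnit g.det ∧
      g * x = y * g ∧
      (∃ (σ : Matrix (Fin N) (Idx r k) L) (τ : Matrix (Idx r k) (Fin N) L),
        (blocks r k).BlockState (maxSize r k) y σ τ) ∧
      (∃ π : Matrix (Fin N) (Idx r k) L, (blocks r k).RowState r k (maxSize r k) y π) ∧
      (blocks r k).Normal r y := by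
  induction k generalizing L with
  | zero =>
    have hE : IsEmpty (Idx r 0) := inferInstanceAs (IsEmpty Empty)
    have hl : levelProj N L 0 = 0 := by
      ext i j
      simp [levelProj]
    have hc : ∀ (σ : Matrix (Fin N) (Idx r 0) L) (τ : Matrix (Idx r 0) (Fin N) L),
        IsCokernel x 0 σ τ := fun σ τ => by
      refine ⟨Subsingleton.elim (h := ?_) _ _, ⟨0, Subsingleton.elim _ _⟩, ?_⟩
      · exact ⟨fun a b => by ext i j; exact (hE.false j).elim⟩
      · rw [hl]
        ext i j
        rw [Matrix.mul_apply, Finset.univ_eq_empty, Finset.sum_empty]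
        rfl
    refine ⟨1, x, blockTriangular_one, by rw [det_one]; exact isUnit_one, by simp,
      ⟨0, 0, hc _ _, fun b a _ h => absurd h (Nat.not_lt_zero _)⟩,
      ⟨0, hc _ _, fun i => (hE.false i).elim⟩, fun i => (hE.false i).elim⟩
  | succ k ih =>
    have hv := blocks_valid r k
    set D := blocks r k with hD
    let x' : Matrix (Idx r k) (Idx r k) L := fun i j => x (Sum.inl i) (Sum.inl j)
    let z : Matrix (Idx r k) (Fin (r k)) L := fun i p => x (Sum.inl i) (Sum.inr p)
    let I := {γ : Idx r k × Idx r k // D.blk γ.1 < D.blk γ.2}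
    let u : I → L := fun γ => x' γ.1.1 γ.1.2
    have hxz : x = fromBlocks x' z 0 0 := by
      ext (i | p) (j | q)
      · rfl
      · rfl
      · exact hx _ _ fun h => lt_asymm h (hv.blk_lt j)
      · exact hx _ _ (lt_irrefl k)
    have hsum : AlgebraicIndependent k₀
        (Sum.elim (fun q : Idx r k × Fin (r k) => z q.1 q.2) u) := by
      let e : (Idx r k × Fin (r k)) ⊕ I → {γ : Idx r (k + 1) × Idx r (k + 1) //
          (blocks r (k + 1)).blk γ.1 < (blocks r (k + 1)).blk γ.2} :=
        Sum.elim (fun q => ⟨(Sum.inl q.1, Sum.inr q.2), hv.blk_lt q.1⟩)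
          (fun γ => ⟨(Sum.inl γ.1.1, Sum.inl γ.1.2), γ.2⟩)
      have he : Function.Injective e := by
        rintro (⟨i, p⟩ | ⟨⟨i, j⟩, h⟩) (⟨i', p'⟩ | ⟨⟨i', j'⟩, h'⟩) heq
        · have h1 := congrArg Subtype.val heq
          have h2 := Sum.inl.inj (congrArg Prod.fst h1)
          have h3 := Sum.inr.inj (congrArg Prod.snd h1)
          dsimp only at h2 h3
          rw [h2, h3]
        · have h1 := congrArg Prod.snd (congrArg Subtype.val heq)
          cases h1
        · have h1 := congrArg Prod.snd (congrArg Subtype.val heq)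
          cases h1
        · have h1 := congrArg Subtype.val heq
          have h2 := Sum.inl.inj (congrArg Prod.fst h1)
          have h3 := Sum.inl.inj (congrArg Prod.snd h1)
          dsimp only at h2 h3
          subst h2 h3
          rfl
      have h1 := hind.comp e he
      convert h1 using 1
      ext (q | γ) <;> rfl
    rw [AlgebraicIndependent.sumElim_iff] at hsum
    obtain ⟨hu, hz⟩ := hsum
    let F := IntermediateField.adjoin k₀ (Set.range u)
    have hzF : AlgebraicIndependent F fun q : Idx r k × Fin (r k) => z q.1 q.2 :=
      IntermediateField.algebraicIndependent_adjoin_iff.2 hz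
    have hx'F : ∀ i j, x' i j ∈ F := by
      intro i j
      by_cases hij : D.blk i < D.blk j
      · exact IntermediateField.subset_adjoin _ _ ⟨⟨(i, j), hij⟩, rfl⟩
      · have : x' i j = 0 := hx (Sum.inl i) (Sum.inl j) hij
        rw [this]
        exact F.zero_mem
    let x'' : Matrix (Idx r k) (Idx r k) F := fun i j => ⟨x' i j, hx'F i j⟩
    obtain ⟨g, y, hg, hgu, hgx, ⟨σ, τ, hσ⟩, ⟨π, hπ⟩, hy⟩ := ih
      (fun s hs => hN s (hs.trans k.lt_succ_self)) F x''
      (fun i j hij => Subtype.ext (hx (Sum.inl i) (Sum.inl j) hij))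
      (AlgebraicIndependent.of_comp F.val hu)
    obtain ⟨g', y', h1, h2, h3, h4, h5, h6⟩ := exists_normal_extension (R := partialSum r k) hv
      (hv.max_le N fun s hs => hN s (hs.trans k.lt_succ_self)) (hN k k.lt_succ_self) hg hgu hgx hσ
      hπ hy hzF
    refine ⟨g', y', h1, h2, ?_, h4, h5, h6⟩
    rw [hxz]
    exact h3

end Generic

/-! ### Explicit description of the base and of `Φ` -/

section Composition

variable {n : ℕ} (c : Composition n)

/-- The sizes of the blocks, continued by zero. -/
def blockSize (t : ℕ) : ℕ := if h : t < c.length then c.blocksFun ⟨t, h⟩ else 0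

/-- The positions of rows and columns with respect to the blocks. -/
def compositionBlocks : Blocks (Fin n) where
  blk i := c.index i
  pos i := i - c.sizeUpTo (c.index i)
  rev i := blockSize c (c.index i) - 1 - (i - c.sizeUpTo (c.index i))
  ord i := i

theorem blockSize_fin (t : Fin c.length) : blockSize c t = c.blocksFun t := by
  rw [blockSize, dif_pos t.2]

theorem lt_length_of_lt_blockSize {q t : ℕ} (h : q < blockSize c t) : t < c.length := by
  by_contra h'
  rw [blockSize, dif_neg h'] at h
  omega

theorem partialSum_blockSize {t : ℕ} (ht : t ≤ c.length) :
    partialSum (blockSize c) t = c.sizeUpTo t := by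
  induction t with
  | zero => rw [Composition.sizeUpTo_zero]; rfl
  | succ t ih =>
    rw [partialSum, Finset.sum_range_succ, ← partialSum, ih (by omega), blockSize,
      dif_pos (Nat.lt_of_succ_le ht), ← Composition.sizeUpTo_succ' c ⟨t, ht⟩]

variable {c}

theorem sizeUpTo_add_pos (i : Fin n) :
    (i : ℕ) = c.sizeUpTo ((compositionBlocks c).blk i) + (compositionBlocks c).pos i := by
  have h1 := c.sizeUpTo_index_le i
  change (i : ℕ) = c.sizeUpTo (c.index i) + (i - c.sizeUpTo (c.index i))
  omega

theorem pos_lt_blockSize (i : Fin n) :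
    (compositionBlocks c).pos i < blockSize c ((compositionBlocks c).blk i) := by
  have h1 := c.sizeUpTo_index_le i
  have h2 := c.lt_sizeUpTo_index_succ i
  change (i : ℕ) - c.sizeUpTo (c.index i) < blockSize c (c.index i)
  rw [Fin.val_succ, Composition.sizeUpTo_succ' c (c.index i)] at h2
  rw [blockSize_fin]
  omega

theorem rev_eq (i : Fin n) : (compositionBlocks c).rev i
    = blockSize c ((compositionBlocks c).blk i) - 1 - (compositionBlocks c).pos i := rfl

theorem rev_lt_blockSize (i : Fin n) :
    (compositionBlocks c).rev i < blockSize c ((compositionBlocks c).blk i) := by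
  have h1 := pos_lt_blockSize (c := c) i
  rw [rev_eq]
  omega

theorem blk_lt_length (i : Fin n) : (compositionBlocks c).blk i < c.length := (c.index i).2

theorem exists_pos {q t : ℕ} (h : q < blockSize c t) :
    ∃ i, (compositionBlocks c).blk i = t ∧ (compositionBlocks c).pos i = q := by
  have ht := lt_length_of_lt_blockSize c h
  rw [blockSize, dif_pos ht] at h
  refine ⟨c.embedding ⟨t, ht⟩ ⟨q, h⟩, ?_, ?_⟩
  · change (c.index _ : ℕ) = t
    rw [Composition.index_embedding]
  · change ((c.embedding ⟨t, ht⟩ ⟨q, h⟩ : Fin n) : ℕ) - c.sizeUpTo (c.index _) = q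
    rw [Composition.index_embedding, Composition.coe_embedding]
    simp

theorem exists_rev {q t : ℕ} (h : q < blockSize c t) :
    ∃ i, (compositionBlocks c).blk i = t ∧ (compositionBlocks c).rev i = q := by
  obtain ⟨i, h1, h2⟩ := exists_pos (c := c) (q := blockSize c t - 1 - q) (t := t) (by omega)
  exact ⟨i, h1, by rw [rev_eq, h1, h2]; omega⟩

theorem eq_of_blk_pos {i j : Fin n} (h : (compositionBlocks c).blk i = (compositionBlocks c).blk j)
    (h' : (compositionBlocks c).pos i = (compositionBlocks c).pos j) : i = j := by
  have h1 := sizeUpTo_add_pos (c := c) i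
  have h2 := sizeUpTo_add_pos (c := c) j
  rw [h, h'] at h1
  exact Fin.ext (h1.trans h2.symm)

theorem lt_of_blk_lt {i j : Fin n} (h : (compositionBlocks c).blk i < (compositionBlocks c).blk j) :
    i < j := by
  have h1 : (i, j) ∈ nilRoots c := h
  exact nilRoots_subset_posRoots c h1

theorem blk_le_of_le {i j : Fin n} (h : i ≤ j) :
    (compositionBlocks c).blk i ≤ (compositionBlocks c).blk j := by
  by_contra h'
  exact absurd (lt_of_blk_lt (not_le.1 h')) h.not_gt

theorem lt_iff_pos_lt {i j : Fin n}
    (h : (compositionBlocks c).blk i = (compositionBlocks c).blk j) :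
    i < j ↔ (compositionBlocks c).pos i < (compositionBlocks c).pos j := by
  have h1 := sizeUpTo_add_pos (c := c) i
  have h2 := sizeUpTo_add_pos (c := c) j
  rw [h] at h1
  rw [Fin.lt_def]
  omega

/-- By uniqueness of the base it is enough that the explicit set is one. It joins the row with `q`
elements after it in its block to the column with `q` elements before it in the next block that has
more than `q` elements. -/
theorem mem_base_iff {i j : Fin n} : (i, j) ∈ base c ↔
    (compositionBlocks c).blk i < (compositionBlocks c).blk j ∧
    (∀ s, (compositionBlocks c).blk i < s → s < (compositionBlocks c).blk j →
      blockSize c s ≤ (compositionBlocks c).pos j) ∧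
    (compositionBlocks c).rev i = (compositionBlocks c).pos j := by
  set D := compositionBlocks c with hD
  have hblk : ∀ {i j}, i ≤ j → D.blk i ≤ D.blk j := blk_le_of_le
  have hpos : ∀ i, D.pos i < blockSize c (D.blk i) := pos_lt_blockSize
  have hrev : ∀ i, D.rev i < blockSize c (D.blk i) := rev_lt_blockSize
  have heq : ∀ i, D.rev i = blockSize c (D.blk i) - 1 - D.pos i := rev_eq
  let T : Set (Fin n × Fin n) := {γ | D.blk γ.1 < D.blk γ.2 ∧
    (∀ s, D.blk γ.1 < s → s < D.blk γ.2 → blockSize c s ≤ D.pos γ.2) ∧ D.rev γ.1 = D.pos γ.2}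
  have hTM : T ⊆ nilRoots c := fun γ h => h.1
  have hT : IsBase c T := by
    refine ⟨hTM, ?_, ?_⟩
    · rintro ⟨i, j⟩ h ⟨i', j'⟩ h' hlt
      rw [rootLT_iff (nilRoots_subset_posRoots c (hTM h)) (nilRoots_subset_posRoots c (hTM h'))]
        at hlt
      obtain ⟨h1, h2, h3⟩ := h
      obtain ⟨h1', h2', h3'⟩ := h'
      dsimp only at h1 h2 h3 h1' h2' h3' hlt
      rcases hlt with ⟨rfl, hlt⟩ | ⟨rfl, hlt⟩
      · rcases (hblk hlt.le).lt_or_eq with h4 | h4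
        · have := h2' _ h1 h4
          have := hpos j
          omega
        · exact hlt.ne (eq_of_blk_pos h4 (h3.symm.trans h3'))
      · rcases (hblk hlt.le).lt_or_eq with h4 | h4
        · have := h2' _ h4 h1
          have := hrev i
          omega
        · have h5 := heq i
          have h6 := heq i'
          have h7 := hpos i
          have h8 := hpos i'
          rw [h4] at h6 h8
          have h9 : D.pos i' = D.pos i := by omega
          exact hlt.ne (eq_of_blk_pos h4 h9)
    · rintro ⟨i, j⟩ hij hn
      have hij' : D.blk i < D.blk j := hij
      have hpj := hpos j
      have hri := hrev i
      rcases le_or_gt (D.rev i) (D.pos j) with hle | hlt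
      -- Here the smaller root lies to the left in row `i`, in the first block that is large enough.
      · have hex : ∃ s, D.blk i < s ∧ D.rev i < blockSize c s :=
          ⟨D.blk j, hij', lt_of_le_of_lt hle hpj⟩
        classical
        have h1 := Nat.find_spec hex
        have h2 : Nat.find hex ≤ D.blk j := Nat.find_min' hex ⟨hij', lt_of_le_of_lt hle hpj⟩
        have h3 : ∀ s, D.blk i < s → s < Nat.find hex → blockSize c s ≤ D.rev i :=
          fun s h4 h5 => by
            by_contra h6
            exact Nat.find_min hex h5 ⟨h4, not_le.1 h6⟩
        set s := Nat.find hex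
        obtain ⟨l, hl, hl'⟩ := exists_pos h1.2
        have hmem : (i, l) ∈ T := by
          refine ⟨?_, ?_, ?_⟩
          · change D.blk i < D.blk l
            rw [hl]
            exact h1.1
          · intro s' h4 h5
            change blockSize c s' ≤ D.pos l
            change s' < D.blk l at h5
            rw [hl] at h5
            rw [hl']
            exact h3 s' h4 h5
          · exact hl'.symm
        refine ⟨_, hmem, ?_⟩
        rw [rootLT_iff (nilRoots_subset_posRoots c (hTM hmem)) (nilRoots_subset_posRoots c hij)]
        refine Or.inl ⟨rfl, ?_⟩
        change l < j
        rcases h2.lt_or_eq with h4 | h4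
        · exact lt_of_blk_lt (by rw [hl]; exact h4)
        · refine lt_of_le_of_ne ?_ ?_
          · rw [← not_lt, lt_iff_pos_lt (c := c) (by rw [hl]; exact h4.symm), hl']
            exact hle.not_gt
          · rintro rfl
            exact hn hmem
      -- Here it lies below in column `j`, in the last block before that of `j` which is large
      -- enough; `q` counts the blocks backwards.
      · have hex : ∃ q, q < D.blk j - D.blk i ∧ D.pos j < blockSize c (D.blk j - 1 - q) :=
          ⟨D.blk j - 1 - D.blk i, by omega, by
            rw [show D.blk j - 1 - (D.blk j - 1 - D.blk i) = D.blk i by omega]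
            exact hlt.trans hri⟩
        classical
        have h1 := Nat.find_spec hex
        have h3 : ∀ q < Nat.find hex, blockSize c (D.blk j - 1 - q) ≤ D.pos j :=
          fun s h5 => by
            by_contra h6
            exact Nat.find_min hex h5 ⟨h5.trans h1.1, not_le.1 h6⟩
        set q := Nat.find hex
        obtain ⟨l, hl, hl'⟩ := exists_rev h1.2
        change D.rev l = _ at hl'
        have hmem : (l, j) ∈ T := by
          refine ⟨?_, ?_, ?_⟩
          · change D.blk l < D.blk j
            rw [hl]
            omega
          · intro s' h4 h5
            change blockSize c s' ≤ D.pos j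
            change D.blk l < s' at h4
            change s' < D.blk j at h5
            rw [hl] at h4
            have := h3 (D.blk j - 1 - s') (by omega)
            rwa [show D.blk j - 1 - (D.blk j - 1 - s') = s' by omega] at this
          · exact hl'
        refine ⟨_, hmem, ?_⟩
        rw [rootLT_iff (nilRoots_subset_posRoots c (hTM hmem)) (nilRoots_subset_posRoots c hij)]
        refine Or.inr ⟨rfl, ?_⟩
        change i < l
        have h5 : D.blk i ≤ D.blk l := by rw [hl]; omega
        rcases h5.lt_or_eq with h4 | h4
        · exact lt_of_blk_lt h4
        · rw [lt_iff_pos_lt (c := c) h4]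
          have h5 := heq i
          have h6 := heq l
          have h7 := hpos i
          have h8 := hpos l
          rw [h4] at h5 h7
          change D.pos i < D.pos l
          omega
  rw [← hT.eq_base]
  rfl

/-- Column `j` contains a base element exactly when some earlier block has more elements than
precede `j` in its block. The base element of column `l` must lie in a lower row of the block of
`j`. -/
theorem mem_phi_iff {j l : Fin n} : (j, l) ∈ phi c ↔
    (compositionBlocks c).blk j < (compositionBlocks c).blk l ∧
    (∀ s, (compositionBlocks c).blk j < s → s < (compositionBlocks c).blk l →
      blockSize c s ≤ (compositionBlocks c).pos l) ∧
    (compositionBlocks c).pos l < (compositionBlocks c).rev j ∧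
    ∃ s < (compositionBlocks c).blk j, (compositionBlocks c).pos j < blockSize c s := by
  set D := compositionBlocks c with hD
  constructor
  · rintro ⟨⟨i, j'⟩, h1, ⟨k, l'⟩, h2, ⟨h3, h4⟩, h5⟩
    obtain ⟨rfl, rfl⟩ := Prod.mk.inj h5
    dsimp only at h3 h4
    have h4' : D.blk j = D.blk k := congrArg Fin.val h4
    rw [mem_base_iff] at h1 h2
    rw [← hD] at h1 h2
    rw [h4']
    refine ⟨h2.1, h2.2.1, ?_, D.blk i, h4' ▸ h1.1, ?_⟩
    · rw [lt_iff_pos_lt (c := c) h4', ← hD] at h3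
      have h5 := rev_eq (c := c) j
      have h6 := rev_eq (c := c) k
      have h7 := pos_lt_blockSize (c := c) k
      rw [← hD] at h5 h6 h7
      rw [h4'] at h5
      omega
    · rw [← h1.2.2]
      exact rev_lt_blockSize i
  · rintro ⟨h1, h2, h3, s, h4, h5⟩
    obtain ⟨k, hk, hk'⟩ := exists_rev (c := c) (h3.trans (rev_lt_blockSize j))
    rw [← hD] at hk hk'
    have hex : ∃ q, q < D.blk j ∧ D.pos j < blockSize c (D.blk j - 1 - q) :=
      ⟨D.blk j - 1 - s, by omega, by
        rwa [show D.blk j - 1 - (D.blk j - 1 - s) = s by omega]⟩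
    classical
    have h6 := Nat.find_spec hex
    have h7 : ∀ q < Nat.find hex, blockSize c (D.blk j - 1 - q) ≤ D.pos j :=
      fun s h8 => by
        by_contra h9
        exact Nat.find_min hex h8 ⟨h8.trans h6.1, not_le.1 h9⟩
    set q := Nat.find hex
    obtain ⟨i, hi, hi'⟩ := exists_rev h6.2
    rw [← hD] at hi hi'
    refine ⟨(i, j), ?_, (k, l), ?_, ⟨?_, ?_⟩, rfl⟩
    · rw [mem_base_iff, ← hD]
      refine ⟨by omega, fun s' h8 h9 => ?_, hi'⟩
      have := h7 (D.blk j - 1 - s') (by omega)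
      rwa [show D.blk j - 1 - (D.blk j - 1 - s') = s' by omega] at this
    · rw [mem_base_iff, ← hD, hk]
      exact ⟨h1, h2, hk'⟩
    · change j < k
      rw [lt_iff_pos_lt (c := c) hk.symm, ← hD]
      have h8 := rev_eq (c := c) j
      have h9 := rev_eq (c := c) k
      rw [← hD] at h8 h9
      rw [hk] at h9
      omega
    · exact Fin.ext hk.symm

theorem mem_extBase_iff {i j : Fin n} :
    (i, j) ∈ extBase c ↔ (compositionBlocks c).InExt (blockSize c) i j := by
  rw [extBase, Set.mem_union, mem_base_iff, mem_phi_iff, Blocks.InExt]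
  tauto

/-- The index set built block by block is `Fin n`. -/
theorem exists_equiv_fin : ∃ e : Idx (blockSize c) c.length ≃ Fin n, ∀ i,
    (compositionBlocks c).blk (e i) = (blocks (blockSize c) c.length).blk i ∧
    (compositionBlocks c).pos (e i) = (blocks (blockSize c) c.length).pos i ∧
    (compositionBlocks c).rev (e i) = (blocks (blockSize c) c.length).rev i ∧
    (e i : ℕ) = (blocks (blockSize c) c.length).ord i := by
  set D := blocks (blockSize c) c.length with hD
  have hv := blocks_valid (blockSize c) c.length
  have hn : partialSum (blockSize c) c.length = n := by
    rw [partialSum_blockSize c le_rfl, Composition.sizeUpTo_length]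
  let f : Idx (blockSize c) c.length → Fin n := fun i => ⟨D.ord i, (hv.ord_lt i).trans_eq hn⟩
  have hf : Function.Bijective f := by
    rw [Fintype.bijective_iff_injective_and_card]
    exact ⟨fun i j h => hv.ord_injective (congrArg Fin.val h), by
      rw [card_idx, hn, Fintype.card_fin]⟩
  refine ⟨Equiv.ofBijective f hf, fun i => ?_⟩
  obtain ⟨h1, h2, h3⟩ := blocks_pos (blockSize c) c.length i
  rw [← hD] at h1 h2 h3
  change (compositionBlocks c).blk (f i) = _ ∧ (compositionBlocks c).pos (f i) = _ ∧
    (compositionBlocks c).rev (f i) = _ ∧ (f i : ℕ) = _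
  obtain ⟨j, hj, hj'⟩ := exists_pos h2
  have hfj : f i = j := by
    refine Fin.ext ?_
    rw [sizeUpTo_add_pos (c := c) j, hj, hj']
    change D.ord i = _
    rw [h1, partialSum_blockSize c (hv.blk_lt i).le]
  rw [hfj]
  refine ⟨hj, hj', ?_, ?_⟩
  · rw [rev_eq, hj, hj', h3]
  · rw [← hfj]

theorem exists_generic_normal_form (K : Type*) [Field K] (c : Composition n) (L : Type*) [Field L]
    [Algebra K L] (x : Matrix (Fin n) (Fin n) L) (hx : ∀ i j, (i, j) ∉ nilRoots c → x i j = 0)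
    (hind : AlgebraicIndependent K fun γ : nilRoots c => x γ.1.1 γ.1.2) :
    ∃ g y : Matrix (Fin n) (Fin n) L, BlockTriangular g id ∧ IsUnit g.det ∧ g * x = y * g ∧
      ∀ i j, ((i, j) ∈ extBase c → y i j ≠ 0) ∧ ((i, j) ∉ extBase c → y i j = 0) := by
  obtain ⟨e, he⟩ := exists_equiv_fin (c := c)
  set D := blocks (blockSize c) c.length with hD
  have hmem : ∀ i j, (e i, e j) ∈ nilRoots c ↔ D.blk i < D.blk j := by
    intro i j
    rw [← (he i).1, ← (he j).1]
    exact Iff.rfl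
  have hind' : AlgebraicIndependent K fun γ : {γ : Idx (blockSize c) c.length ×
      Idx (blockSize c) c.length // D.blk γ.1 < D.blk γ.2} => x.submatrix e e γ.1.1 γ.1.2 := by
    let f : {γ : Idx (blockSize c) c.length × Idx (blockSize c) c.length //
        D.blk γ.1 < D.blk γ.2} → nilRoots c :=
      fun γ => ⟨(e γ.1.1, e γ.1.2), (hmem _ _).2 γ.2⟩
    have hf : Function.Injective f := by
      rintro ⟨⟨i, j⟩, h⟩ ⟨⟨i', j'⟩, h'⟩ heq
      have h1 := congrArg Subtype.val heq
      obtain ⟨h2, h3⟩ := Prod.mk.inj h1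
      have h4 := e.injective h2
      have h5 := e.injective h3
      dsimp only at h4 h5
      subst h4 h5
      rfl
    exact hind.comp f hf
  obtain ⟨g, y, h1, h2, h3, -, -, h4⟩ := exists_normal_form K (blockSize c)
    (N := maxSize (blockSize c) c.length) c.length (fun s hs => le_maxSize _ hs) L
    (x.submatrix e e) (fun i j hij => hx _ _ fun h => hij ((hmem i j).1 h)) hind'
  refine ⟨g.submatrix e.symm e.symm, y.submatrix e.symm e.symm, ?_, ?_, ?_, ?_⟩
  · intro i j hij
    refine h1 ?_
    rw [← (he _).2.2.2, ← (he _).2.2.2, e.apply_symm_apply, e.apply_symm_apply]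
    exact hij
  · rwa [det_submatrix_equiv_self]
  · have h5 : x = (x.submatrix e e).submatrix e.symm e.symm := by
      ext i j
      simp
    rw [h5, submatrix_mul_equiv, submatrix_mul_equiv, h3]
  · intro i j
    have h5 : (i, j) ∈ extBase c ↔ D.InExt (blockSize c) (e.symm i) (e.symm j) := by
      rw [mem_extBase_iff, Blocks.InExt, Blocks.InExt, ← (he (e.symm i)).1, ← (he (e.symm j)).1,
        ← (he (e.symm i)).2.1, ← (he (e.symm j)).2.1, ← (he (e.symm i)).2.2.1, e.apply_symm_apply,
        e.apply_symm_apply]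
    rw [h5]
    exact h4 _ _

end Composition

/-! ### From the generic matrix to a Zariski open set -/

section Specialise

variable {n : ℕ}

theorem nonempty_and_isZariskiOpen {K : Type*} [Field K] [Infinite K] (c : Composition n)
    {f : MvPolynomial (nilRoots c) K} (hf : f ≠ 0) :
    {x : nilradical K c | MvPolynomial.eval (coords c x) f ≠ 0}.Nonempty ∧
      IsZariskiOpen c {x : nilradical K c | MvPolynomial.eval (coords c x) f ≠ 0} := by
  classical
  constructor
  · obtain ⟨v, hv⟩ : ∃ v, MvPolynomial.eval v f ≠ 0 := by
      by_contra! h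
      exact hf (MvPolynomial.funext fun v => by rw [h v, map_zero])
    let x : Matrix (Fin n) (Fin n) K :=
      fun i j => if h : (i, j) ∈ nilRoots c then v ⟨(i, j), h⟩ else 0
    have hx : x ∈ nilradical K c := fun i j hij => dif_neg hij
    refine ⟨⟨x, hx⟩, ?_⟩
    have : coords c ⟨x, hx⟩ = v := funext fun γ => dif_pos γ.2
    rw [Set.mem_ofPred_eq, this]
    exact hv
  · refine ⟨Ideal.span {f}, ?_⟩
    ext x
    rw [MvPolynomial.zeroLocus_span]
    simp [MvPolynomial.aeval_eq_eval]

theorem exists_zariskiOpen_normal_form (K : Type*) [Field K] [Infinite K] (c : Composition n) :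
    ∃ U : Set (nilradical K c), U.Nonempty ∧ IsZariskiOpen c U ∧
      ∀ x ∈ U, ∃ g y : Matrix (Fin n) (Fin n) K, BlockTriangular g id ∧ IsUnit g.det ∧
        g * x = y * g ∧
        ∀ i j, ((i, j) ∈ extBase c → y i j ≠ 0) ∧ ((i, j) ∉ extBase c → y i j = 0) := by
  classical
  let A := MvPolynomial (nilRoots c) K
  let L := FractionRing A
  let a := algebraMap A L
  have ha : Function.Injective a := IsFractionRing.injective A L
  let X : Matrix (Fin n) (Fin n) A :=
    fun i j => if h : (i, j) ∈ nilRoots c then MvPolynomial.X ⟨(i, j), h⟩ else 0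
  have hind : AlgebraicIndependent K fun γ : nilRoots c => X.map a γ.1.1 γ.1.2 := by
    have h1 : AlgebraicIndependent K (MvPolynomial.X : nilRoots c → A) :=
      MvPolynomial.algebraicIndependent_X _ _
    have h2 := h1.map' (f := IsScalarTower.toAlgHom K A L) ha
    convert h2 using 1
    funext γ
    exact congrArg a (dif_pos γ.2)
  obtain ⟨g, y, hg, hgu, hgx, hy⟩ := exists_generic_normal_form K c L (X.map a)
    (fun i j hij => by
      have h1 : X i j = 0 := dif_neg hij
      rw [map_apply, h1, map_zero]) hind
  -- A common denominator of all entries of `g` and `y`.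
  obtain ⟨d, hd⟩ := IsLocalization.exist_integer_multiples_of_finite (nonZeroDivisors A)
    (Sum.elim (fun q : Fin n × Fin n => g q.1 q.2) fun q : Fin n × Fin n => y q.1 q.2)
  have hG : ∃ G : Matrix (Fin n) (Fin n) A, G.map a = (d : A) • g :=
    ⟨fun i j => (hd (Sum.inl (i, j))).choose, by
      ext i j
      exact (hd (Sum.inl (i, j))).choose_spec⟩
  have hY : ∃ Y : Matrix (Fin n) (Fin n) A, Y.map a = (d : A) • y :=
    ⟨fun i j => (hd (Sum.inr (i, j))).choose, by
      ext i j
      exact (hd (Sum.inr (i, j))).choose_spec⟩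
  obtain ⟨G, hG⟩ := hG
  obtain ⟨Y, hY⟩ := hY
  have hd0 : (d : A) ≠ 0 := nonZeroDivisors.ne_zero d.2
  have hda : a d ≠ 0 := (map_ne_zero_iff a ha).2 hd0
  have hGX : (d : A) • (G * X) = Y * G := by
    apply Matrix.map_injective ha
    change ((d : A) • (G * X)).map a = (Y * G).map a
    rw [Matrix.map_mul, hY, hG]
    have h1 : ((d : A) • (G * X)).map a = (d : A) • (G.map a * X.map a) := by
      rw [← Matrix.map_mul]
      ext i j
      rw [map_apply, Matrix.smul_apply, smul_eq_mul, map_mul, Matrix.smul_apply, map_apply,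
        Algebra.smul_def]
    rw [h1, hG, Matrix.smul_mul, Matrix.smul_mul, Matrix.mul_smul, hgx]
  have hGt : BlockTriangular G id := by
    intro i j hij
    apply ha
    have h1 := congrFun (congrFun hG i) j
    rw [map_apply] at h1
    rw [h1, Matrix.smul_apply, hg hij, smul_zero, map_zero]
  have hGd : G.det ≠ 0 := by
    intro h0
    have h1 : (G.map a).det = 0 := by
      rw [← RingHom.mapMatrix_apply, ← RingHom.map_det, h0, map_zero]
    have h2 : (d : A) • g = a d • g := by
      ext i j
      simp [Algebra.smul_def, a]
    rw [hG, h2, det_smul] at h1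
    exact mul_ne_zero (pow_ne_zero _ hda) hgu.ne_zero h1
  have hYs : ∀ i j, ((i, j) ∈ extBase c → Y i j ≠ 0) ∧ ((i, j) ∉ extBase c → Y i j = 0) := by
    intro i j
    have h1 := congrFun (congrFun hY i) j
    rw [map_apply, Matrix.smul_apply, Algebra.smul_def] at h1
    refine ⟨fun h h0 => ?_, fun h => ha ?_⟩
    · rw [h0, map_zero] at h1
      exact mul_ne_zero hda ((hy i j).1 h) h1.symm
    · rw [h1, (hy i j).2 h, mul_zero, map_zero]
  -- Where this does not vanish, the denominator and the determinant stay nonzero and so do the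
  -- entries in the extended base.
  let f : A := G.det * d * ∏ q : Fin n × Fin n, if q ∈ extBase c then Y q.1 q.2 else 1
  have hf : f ≠ 0 := by
    refine mul_ne_zero (mul_ne_zero hGd hd0) (Finset.prod_ne_zero_iff.2 fun q _ => ?_)
    split_ifs with hq
    · exact (hYs q.1 q.2).1 hq
    · exact one_ne_zero
  obtain ⟨h1, h2⟩ := nonempty_and_isZariskiOpen c hf
  refine ⟨_, h1, h2, fun x hx => ?_⟩
  let ev := MvPolynomial.eval (coords c x)
  have hx' : ev f ≠ 0 := hx
  rw [map_mul, map_mul, map_prod] at hx'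
  have hdet := left_ne_zero_of_mul (left_ne_zero_of_mul hx')
  have hevd := right_ne_zero_of_mul (left_ne_zero_of_mul hx')
  have hprod := Finset.prod_ne_zero_iff.1 (right_ne_zero_of_mul hx')
  have hX : X.map ev = x := by
    ext i j
    by_cases hij : (i, j) ∈ nilRoots c
    · have h3 : X i j = MvPolynomial.X ⟨(i, j), hij⟩ := dif_pos hij
      rw [map_apply, h3]
      exact MvPolynomial.eval_X _
    · have h3 : X i j = 0 := dif_neg hij
      rw [map_apply, h3, map_zero]
      exact (x.2 i j hij).symm
  refine ⟨G.map ev, (ev d)⁻¹ • Y.map ev, ?_, ?_, ?_, fun i j => ⟨fun h => ?_, fun h => ?_⟩⟩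
  · intro i j hij
    rw [map_apply, hGt hij, map_zero]
  · rw [← RingHom.mapMatrix_apply, ← RingHom.map_det]
    exact isUnit_iff_ne_zero.2 hdet
  · have h3 : ev d • (G.map ev * x) = Y.map ev * G.map ev := by
      rw [← hX, ← Matrix.map_mul, ← Matrix.map_mul, ← hGX]
      ext i j
      exact (map_mul ev (d : A) ((G * X) i j)).symm
    rw [Matrix.smul_mul, ← h3, smul_smul, inv_mul_cancel₀ hevd, one_smul]
  · have h3 := hprod (i, j) (Finset.mem_univ _)
    rw [if_pos h] at h3
    exact mul_ne_zero (inv_ne_zero hevd) h3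
  · rw [Matrix.smul_apply, map_apply, (hYs i j).2 h, map_zero, smul_zero]

end Specialise

/-! ### Scaling by the torus -/

section Torus

/-- Remove the edge at a leaf, scale the remaining edges, and choose the value at the leaf to fit
the removed edge; no other edge is affected. -/
theorem exists_scaling {K V : Type*} [Field K] [DecidableEq V] (E : Finset (V × V))
    (hne : ∀ e ∈ E, e.1 ≠ e.2)
    (hleaf : ∀ E' ⊆ E, E'.Nonempty → ∃ v, ∃ e ∈ E', (e.1 = v ∨ e.2 = v) ∧
      ∀ e' ∈ E', e'.1 = v ∨ e'.2 = v → e' = e)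
    (y : V → V → K) (hy : ∀ e ∈ E, y e.1 e.2 ≠ 0) :
    ∃ t : V → K, (∀ v, t v ≠ 0) ∧ ∀ e ∈ E, t e.1 * y e.1 e.2 = t e.2 := by
  induction hn : E.card generalizing E with
  | zero =>
    refine ⟨fun _ => 1, fun _ => one_ne_zero, fun e he => ?_⟩
    rw [Finset.card_eq_zero.1 hn] at he
    exact absurd he (Finset.notMem_empty e)
  | succ m ih =>
    obtain ⟨v, e, he, hv, huniq⟩ := hleaf E subset_rfl (Finset.card_pos.1 (by omega))
    have hsub : E.erase e ⊆ E := Finset.erase_subset _ _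
    obtain ⟨t, ht, hty⟩ := ih (E.erase e) (fun e' h => hne e' (hsub h))
      (fun E' h => hleaf E' (h.trans hsub)) (fun e' h => hy e' (hsub h))
      (by rw [Finset.card_erase_of_mem he]; omega)
    have hother : ∀ (a : K), ∀ e' ∈ E, e' ≠ e →
        Function.update t v a e'.1 * y e'.1 e'.2 = Function.update t v a e'.2 := by
      intro a e' he' hee
      have h1 : e'.1 ≠ v := fun h => hee (huniq e' he' (Or.inl h))
      have h2 : e'.2 ≠ v := fun h => hee (huniq e' he' (Or.inr h))
      rw [Function.update_of_ne h1, Function.update_of_ne h2]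
      exact hty e' (Finset.mem_erase.2 ⟨hee, he'⟩)
    have hnz : ∀ a : K, a ≠ 0 → ∀ u, Function.update t v a u ≠ 0 := by
      intro a ha u
      by_cases hu : u = v
      · rw [hu, Function.update_self]
        exact ha
      · rw [Function.update_of_ne hu]
        exact ht u
    have hye := hy e he
    rcases hv with rfl | rfl
    · refine ⟨Function.update t e.1 (t e.2 / y e.1 e.2), hnz _ (div_ne_zero (ht _) hye),
        fun e' he' => ?_⟩
      by_cases hee : e' = e
      · subst hee
        rw [Function.update_self, Function.update_of_ne (hne e' he').symm, div_mul_cancel₀ _ hye]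
      · exact hother _ e' he' hee
    · refine ⟨Function.update t e.2 (t e.1 * y e.1 e.2), hnz _ (mul_ne_zero (ht _) hye),
        fun e' he' => ?_⟩
      by_cases hee : e' = e
      · subst hee
        rw [Function.update_self, Function.update_of_ne (hne e' he')]
      · exact hother _ e' he' hee

variable {n : ℕ} {c : Composition n}

theorem exists_first_column {i : Fin n} {q u : ℕ} (hu : (compositionBlocks c).blk i < u)
    (hq : q < blockSize c u) : ∃ a, (compositionBlocks c).pos a = q ∧
      (compositionBlocks c).blk i < (compositionBlocks c).blk a ∧
      ∀ s, (compositionBlocks c).blk i < s → q < blockSize c s →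
        (compositionBlocks c).blk a ≤ s := by
  classical
  have hex : ∃ s, (compositionBlocks c).blk i < s ∧ q < blockSize c s := ⟨u, hu, hq⟩
  obtain ⟨h1, h2⟩ := Nat.find_spec hex
  obtain ⟨a, ha, ha'⟩ := exists_pos h2
  exact ⟨a, ha', ha ▸ h1, fun s h3 h4 => ha ▸ Nat.find_min' hex ⟨h3, h4⟩⟩

theorem blockSize_pos {t : ℕ} (ht : t < c.length) : 0 < blockSize c t := by
  rw [blockSize, dif_pos ht]
  exact c.one_le_blocksFun _

theorem pos_le_rev {i j : Fin n} (h : (compositionBlocks c).InExt (blockSize c) i j) :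
    (compositionBlocks c).pos j ≤ (compositionBlocks c).rev i := by
  rcases h.2.2 with h1 | h1
  · exact h1.ge
  · exact h1.1.le

theorem column_unique {i j j' : Fin n} (h : (compositionBlocks c).InExt (blockSize c) i j)
    (h' : (compositionBlocks c).InExt (blockSize c) i j')
    (hj : (compositionBlocks c).pos j = (compositionBlocks c).pos j') : j = j' := by
  have h1 := pos_lt_blockSize (c := c) j
  have h2 := pos_lt_blockSize (c := c) j'
  rcases lt_trichotomy ((compositionBlocks c).blk j) ((compositionBlocks c).blk j') with h3 | h3 | h3
  · have := h'.2.1 _ h.1 h3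
    omega
  · exact eq_of_blk_pos h3 hj
  · have := h.2.1 _ h'.1 h3
    omega

theorem blk_unique {i i' j : Fin n} (h : (compositionBlocks c).InExt (blockSize c) i j)
    (h' : (compositionBlocks c).InExt (blockSize c) i' j) :
    (compositionBlocks c).blk i = (compositionBlocks c).blk i' := by
  have h1 := rev_lt_blockSize (c := c) i
  have h2 := rev_lt_blockSize (c := c) i'
  have h3 := pos_le_rev h
  have h4 := pos_le_rev h'
  rcases lt_trichotomy ((compositionBlocks c).blk i) ((compositionBlocks c).blk i') with h5 | h5 | h5
  · have := h.2.1 _ h5 h'.1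
    omega
  · exact h5
  · have := h'.2.1 _ h5 h.1
    omega

/-- With `k = pos i + 1`, the first row of block `s` meets `Φ` at each of the positions `0, …, k -
1`, in the nearest later block containing that position. The condition `0 < s` supplies the earlier
nonempty block that membership in `Φ` requires. -/
theorem mem_psiTwo {i w : Fin n} (hphi : (i, w) ∈ phi c)
    (hw : (compositionBlocks c).pos w = 0)
    (hb : (compositionBlocks c).blk w = (compositionBlocks c).blk i + 1) {s : ℕ} (hs : 0 < s)
    (hsi : s < (compositionBlocks c).blk i)
    (hp : (compositionBlocks c).pos i + 1 < blockSize c s)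
    (hp' : (compositionBlocks c).pos i + 1 < blockSize c ((compositionBlocks c).blk i)) :
    (i, w) ∈ psiTwo c := by
  set D := compositionBlocks c with hD
  have hlen : D.blk i < c.length := blk_lt_length i
  obtain ⟨v, hv, hv'⟩ := exists_pos (c := c) (q := 0) (t := s) (by omega)
  rw [← hD] at hv hv'
  have hcol : ∀ q : Fin (D.pos i + 1), ∃ a, D.pos a = q ∧ D.blk v < D.blk a ∧
      ∀ s', D.blk v < s' → (q : ℕ) < blockSize c s' → D.blk a ≤ s' :=
    fun q => exists_first_column (u := D.blk i) (by rw [← hD, hv]; exact hsi)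
      (by have := q.2; omega)
  choose a ha hva hmin using hcol
  refine ⟨hphi, c.index i, D.pos i + 1, by omega, ?_, ?_, ?_, ⟨s, hsi.trans hlen⟩, hsi, v, ?_, a,
    ?_, fun q => ?_⟩
  · rw [← blockSize_fin]
    exact hp'
  · have h1 := sizeUpTo_add_pos (c := c) i
    rw [← hD] at h1
    change (i : ℕ) + 1 = c.sizeUpTo (D.blk i) + _
    omega
  · have h1 := sizeUpTo_add_pos (c := c) w
    rw [← hD, hw, hb] at h1
    exact h1
  · have h1 := sizeUpTo_add_pos (c := c) v
    rw [← hD, hv, hv'] at h1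
    exact h1
  · intro q q' hqq
    have h1 := pos_lt_blockSize (c := c) (a q')
    rw [← hD, ha] at h1
    have h0 : (q : ℕ) < q' := hqq
    rcases (hmin q _ (hva q') (by omega)).lt_or_eq with h2 | h2
    · exact lt_of_blk_lt h2
    · rw [lt_iff_pos_lt (c := c) h2, ← hD, ha, ha]
      exact h0
  · rw [mem_phi_iff, ← hD]
    refine ⟨hva q, fun s' h1 h2 => ?_, ?_, 0, by omega, ?_⟩
    · rw [ha]
      by_contra h3
      exact absurd (hmin q s' h1 (not_le.1 h3)) h2.not_ge
    · have h1 := rev_eq (c := c) v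
      rw [← hD, hv, hv'] at h1
      have := q.2
      rw [ha]
      omega
    · rw [hv']
      exact blockSize_pos (by omega)

/-- Without a leaf, the last column `w` used by `E` contains two elements of `E`. The upper one is
in `Φ`, and it turns out to lie in `Ψ₁` unless `w` begins its block, and otherwise in `Ψ₂`. -/
theorem exists_leaf {E : Finset (Fin n × Fin n)} (hE : ∀ e ∈ E, e ∈ extBase c \ psi c)
    (hne : E.Nonempty) : ∃ v, ∃ e ∈ E, (e.1 = v ∨ e.2 = v) ∧
      ∀ e' ∈ E, e'.1 = v ∨ e'.2 = v → e' = e := by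
  by_contra hno
  push Not at hno
  set D := compositionBlocks c with hD
  have hext : ∀ {i j}, (i, j) ∈ E → D.InExt (blockSize c) i j :=
    fun h => mem_extBase_iff.1 (hE _ h).1
  -- Otherwise row `i` has only its base element and column `i` is empty, so `i` would be a leaf.
  have hfresh : ∀ {i j}, (i, j) ∈ E → ∃ s < D.blk i, D.pos i < blockSize c s := by
    intro i j hij
    by_contra hfr
    obtain ⟨⟨a, b⟩, hab, hv, hneq⟩ := hno i (i, j) hij (Or.inl rfl)
    rcases hv with hv | hv
    · dsimp only at hv
      subst hv
      have h1 := hext hij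
      have h2 := hext hab
      apply hneq
      rw [column_unique h2 h1 (((h2.2.2.resolve_right fun h => hfr h.2).symm.trans
        (h1.2.2.resolve_right fun h => hfr h.2)))]
    · dsimp only at hv
      subst hv
      exact hfr ⟨D.blk a, (hext hab).1, lt_of_le_of_lt (pos_le_rev (hext hab)) (rev_lt_blockSize a)⟩
  obtain ⟨⟨a, w⟩, haw, hmax'⟩ := E.exists_max_image (fun e => e.2) hne
  have hmax : ∀ {i j}, (i, j) ∈ E → j ≤ w := fun h => hmax' _ h
  obtain ⟨i₁, i₂, hlt, h₁, h₂⟩ : ∃ i₁ i₂, i₁ < i₂ ∧ (i₁, w) ∈ E ∧ (i₂, w) ∈ E := by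
    obtain ⟨⟨a', b⟩, hab, hv, hneq⟩ := hno w (a, w) haw (Or.inr rfl)
    rcases hv with hv | hv
    · dsimp only at hv
      subst hv
      exact absurd (lt_of_blk_lt (hext hab).1) (hmax hab).not_gt
    · dsimp only at hv
      subst hv
      rcases lt_trichotomy a a' with h | h | h
      · exact ⟨a, a', h, haw, hab⟩
      · exact absurd (by rw [h]) hneq
      · exact ⟨a', a, h, hab, haw⟩
  have hblk : D.blk i₁ = D.blk i₂ := blk_unique (hext h₁) (hext h₂)
  have hpos : D.pos i₁ < D.pos i₂ := (lt_iff_pos_lt (c := c) hblk).1 hlt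
  obtain ⟨s₂, hs₂, hs₂'⟩ := hfresh h₂
  have hr₁ : D.rev i₁ = blockSize c (D.blk i₁) - 1 - D.pos i₁ := rev_eq i₁
  have hr₂ : D.rev i₂ = blockSize c (D.blk i₂) - 1 - D.pos i₂ := rev_eq i₂
  have hp₂ : D.pos i₂ < blockSize c (D.blk i₂) := pos_lt_blockSize i₂
  have hw₂ : D.pos w ≤ D.rev i₂ := pos_le_rev (hext h₂)
  rw [hblk] at hr₁
  have hphi : (i₁, w) ∈ phi c := by
    rw [mem_phi_iff]
    exact ⟨(hext h₁).1, (hext h₁).2.1, by rw [← hD]; omega, s₂, by rw [← hD]; omega, by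
      rw [← hD]; omega⟩
  have hnot : (i₁, w) ∉ psi c := (hE _ h₁).2
  rcases Nat.eq_zero_or_pos (D.pos w) with hw | hw
  · have hbw : D.blk w = D.blk i₁ + 1 := by
      by_contra h
      have h1 := (hext h₁).1
      have h2 := (hext h₁).2.1 (D.blk i₁ + 1) (by omega) (by omega)
      have h3 : D.blk w < c.length := blk_lt_length w
      have h4 := blockSize_pos (c := c) (t := D.blk i₁ + 1) (by omega)
      omega
    -- These bounds leave no room for a second edge at `i₂`: a later column is excluded by
    -- maximality of `w`, and an element of column `i₂` would lie in a block, other than the first,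
    -- with more than `pos i₂` elements.
    have hsmall : ∀ s, 0 < s → s < D.blk i₁ → blockSize c s ≤ D.pos i₁ + 1 := by
      intro s hs hsi
      by_contra h
      exact hnot (Or.inr (mem_psiTwo hphi hw hbw hs hsi (not_le.1 h) (by rw [← hD, hblk]; omega)))
    obtain ⟨⟨x, x'⟩, hx, hv, hneq⟩ := hno i₂ (i₂, w) h₂ (Or.inl rfl)
    rcases hv with hv | hv
    · dsimp only at hv
      subst hv
      apply hneq
      have h1 := hmax hx
      have h2 := (hext hx).1
      rcases h1.lt_or_eq with h3 | h3
      · have h4 : D.blk x' ≤ D.blk w := blk_le_of_le h1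
        have h5 : D.blk x' = D.blk w := by omega
        have h6 : D.pos x' < D.pos w := (lt_iff_pos_lt (c := c) h5).1 h3
        omega
      · rw [h3]
    · dsimp only at hv
      subst hv
      have h1 := pos_le_rev (hext hx)
      have h2 := rev_lt_blockSize (c := c) x
      have h3 := (hext hx).1
      obtain ⟨s, hs, -⟩ := hfresh hx
      have h4 := hsmall (D.blk x) (by omega) (by omega)
      rw [← hD] at h1 h2
      omega
  -- The column `a` one position earlier, in the nearest block having it, completes a rectangle with
  -- the rows `i₁`, `i₂` and the column `w`.
  · obtain ⟨a, ha, ha', hmin⟩ := exists_first_column (c := c) (i := i₁) (q := D.pos w - 1)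
      (u := D.blk w) (hext h₁).1 (by have := pos_lt_blockSize (c := c) w; rw [← hD] at this; omega)
    rw [← hD] at ha ha' hmin
    have hbet : ∀ s, D.blk i₁ < s → s < D.blk a → blockSize c s ≤ D.pos a := by
      intro s h1 h2
      by_contra h3
      exact absurd (hmin s h1 (by omega)) h2.not_ge
    refine hnot (Or.inl ⟨hphi, i₂, a, hlt, ?_, ?_, ?_, (hE _ h₂).1⟩)
    · have h1 : D.blk a ≤ D.blk w := hmin _ (hext h₁).1 (by
        have := pos_lt_blockSize (c := c) w
        rw [← hD] at this
        omega)
      rcases h1.lt_or_eq with h2 | h2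
      · exact lt_of_blk_lt h2
      · have h3 : D.pos a < D.pos w := by omega
        exact (lt_iff_pos_lt (c := c) h2).2 h3
    · change (i₁, a) ∈ extBase c
      exact mem_extBase_iff.2 ⟨ha', hbet, Or.inr ⟨by rw [← hD]; omega, s₂, by rw [← hD]; omega, by
        rw [← hD]; omega⟩⟩
    · rw [hblk] at ha' hbet
      exact mem_extBase_iff.2 ⟨ha', hbet, Or.inr ⟨by rw [← hD]; omega, s₂, hs₂, hs₂'⟩⟩

theorem exists_torus {K : Type*} [Field K] (c : Composition n) {y : Matrix (Fin n) (Fin n) K}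
    (hy : ∀ i j, (i, j) ∈ extBase c → y i j ≠ 0) :
    ∃ t : Fin n → K, (∀ i, t i ≠ 0) ∧ ∀ i j, (i, j) ∈ extBase c \ psi c → t i * y i j = t j := by
  classical
  let E : Finset (Fin n × Fin n) := Finset.univ.filter fun e => e ∈ extBase c \ psi c
  have hE : ∀ e, e ∈ E ↔ e ∈ extBase c \ psi c := fun e => by simp [E]
  obtain ⟨t, h1, h2⟩ := exists_scaling E
    (fun e he => (lt_of_blk_lt (mem_extBase_iff.1 ((hE e).1 he).1).1).ne)
    (fun E' h h' => exists_leaf (fun e he => (hE e).1 (h he)) h') y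
    (fun e he => hy e.1 e.2 ((hE e).1 he).1)
  exact ⟨t, h1, fun i j hij => h2 (i, j) ((hE _).2 hij)⟩

theorem exists_borel_conj_mem_canonicalSet {K : Type*} [Field K] (c : Composition n)
    {x g y : Matrix (Fin n) (Fin n) K} (hg : BlockTriangular g id) (hgu : IsUnit g.det)
    (hgx : g * x = y * g)
    (hy : ∀ i j, ((i, j) ∈ extBase c → y i j ≠ 0) ∧ ((i, j) ∉ extBase c → y i j = 0)) :
    ∃ h ∈ borel n K, (h : Matrix (Fin n) (Fin n) K) * x * ((h⁻¹ : GL (Fin n) K) :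
      Matrix (Fin n) (Fin n) K) ∈ canonicalSet K c := by
  obtain ⟨t, ht, hty⟩ := exists_torus c fun i j => (hy i j).1
  have hT : (diagonal t).det ≠ 0 := by
    rw [det_diagonal]
    exact Finset.prod_ne_zero_iff.2 fun i _ => ht i
  have hTT : diagonal (fun i => (t i)⁻¹) * diagonal t = 1 := by
    rw [diagonal_mul_diagonal, ← diagonal_one]
    exact congrArg diagonal (funext fun i => inv_mul_cancel₀ (ht i))
  let h : GL (Fin n) K := GeneralLinearGroup.mkOfDetNeZero (diagonal t * g)
    (by rw [det_mul]; exact mul_ne_zero hT hgu.ne_zero)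
  have hcoe : (h : Matrix (Fin n) (Fin n) K) = diagonal t * g := rfl
  have hconj : (h : Matrix (Fin n) (Fin n) K) * x * ((h⁻¹ : GL (Fin n) K) :
      Matrix (Fin n) (Fin n) K) = diagonal t * y * diagonal fun i => (t i)⁻¹ := by
    have h1 : (h : Matrix (Fin n) (Fin n) K) * x
        = diagonal t * y * (diagonal fun i => (t i)⁻¹) * (h : Matrix (Fin n) (Fin n) K) := by
      rw [hcoe, Matrix.mul_assoc, hgx, Matrix.mul_assoc (diagonal t * y),
        ← Matrix.mul_assoc _ (diagonal t) g, hTT, Matrix.one_mul, Matrix.mul_assoc]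
    rw [h1, Matrix.mul_assoc, ← Units.val_mul, mul_inv_cancel, Units.val_one, Matrix.mul_one]
  refine ⟨h, ?_, ?_⟩
  · change BlockTriangular (diagonal t * g) id
    exact (blockTriangular_diagonal t).mul hg
  · rw [hconj]
    intro i j
    rw [mul_diagonal, diagonal_mul]
    refine ⟨fun hij => ?_, fun hij => ?_, fun hij => ?_⟩
    · have h1 : (i, j) ∈ extBase c := by
        rcases hij with h2 | h2
        · exact Or.inr h2.1
        · exact Or.inr h2.1
      exact mul_ne_zero (mul_ne_zero (ht i) ((hy i j).1 h1)) (inv_ne_zero (ht j))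
    · rw [hty i j hij, mul_inv_cancel₀ (ht j)]
    · rw [(hy i j).2 hij, mul_zero, zero_mul]

end Torus

end BorelNilradical

theorem theorem4p1 (K : Type*) [Field K] [IsAlgClosed K] [CharZero K] (n : ℕ) (c : Composition n) :
    ∃ U : Set (BorelNilradical.nilradical K c),
      U.Nonempty ∧ BorelNilradical.IsZariskiOpen c U ∧
        ∀ x ∈ U, ∃ g ∈ BorelNilradical.borel n K,
          (g : Matrix (Fin n) (Fin n) K) * (x : Matrix (Fin n) (Fin n) K)
            * ((g⁻¹ : Matrix.GeneralLinearGroup (Fin n) K) : Matrix (Fin n) (Fin n) K)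
            ∈ BorelNilradical.canonicalSet K c := by
  have : Infinite K := inferInstance
  obtain ⟨U, h1, h2, h3⟩ := BorelNilradical.exists_zariskiOpen_normal_form K c
  refine ⟨U, h1, h2, fun x hx => ?_⟩
  obtain ⟨g, y, hg, hgu, hgx, hy⟩ := h3 x hx
  exact BorelNilradical.exists_borel_conj_mem_canonicalSet c hg hgu hgx hy
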